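/- Call a pair $(G,\Phi)$, consisting of a finite simple graph $G=(V,E)$ and an injective map $\Phi:\{1,\dots,n\}\to V$, a graph realisation of an $n\times n$ matrix $D$ with non-negative integer entries if the shortest-path distance of $G$ satisfies $d_G(\Phi(i),\Phi(j))=D_{ij}$ for all $i,j$. The problem $1$-CombDMR asks, for such an input matrix $D$ (entries written in binary), whether $D$ has a graph realisation with $|V|\le n+1$. For a matrix $D$ and $q\ge 1$, let the $q$-skeleton of $D$ be the weighted graph on $\{1,\dots,n\}$ in which $\{i,j\}$ with $i<j$ is an edge, of length $D_{ij}$, if and only if $D_{ij}\le q$; let $D^{(q)}$ be its matrix of shortest-path distances (with value $\infty$ if there is no path), and let $G_D$ be the $1$-skeleton without weights. Let $\varphi_1$ be the 2-SAT instance in variables $x_1,\dots,x_n$ with the clause $\bar x_i\vee\bar x_j$ for all $i,j$ with $D_{ij}>2$, and the clauses $x_i\vee x_i$ and $x_j\vee x_j$ for all $i,j$ with $D_{ij}=2$ and $d_{G_D}(i,j)>2$. For an assignment $X$ let $G_{\varphi_1,X}$ be the graph obtained from $G_D$ by adding one vertex that is adjacent to exactly those $i$ with $x_i$ true, and let $D(\varphi_1,X)$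 be the matrix of its distances between the vertices $1,\dots,n$. Consider the following algorithm: solve $\varphi_1$; if it is not satisfiable, answer NO; otherwise take a satisfying assignment $X$, and output $G_{\varphi_1,X}$ with $\Phi(i)=i$ if $D(\varphi_1,X)=D$, and answer NO if $D(\varphi_1,X)\ne D$. Theorem. $1$-CombDMR is solvable in polynomial time. Moreover, if $D$ is a YES-instance of $1$-CombDMR, then a graph realisation of $D$ with exactly $n+1$ vertices can be computed within the same polynomial time bound. More precisely: (a) whichever satisfying assignments of $\varphi_1$ are used, the algorithm answers NO if $D$ is a NO-instance, and outputs a graph realisation of $D$ with $n+1$ vertices if $D$ is a YES-instance; (b) for a suitable choice of the satisfying assignments of $\varphi_1$ (one for every $D$ for which $\varphi_1$ is satisfiable), the output of the algorithm is computable by a Turing machine in polynomial time, and $1$-CombDMR is decidable by a Turing machine within the same polynomial time bound; (c) if $D$ is a distance matrix (zero exactly on the diagonal, symmetric, satisfying the triangle inequality), then $D(\varphi_1,X)=D^{(2)}$ for every satisfying assignment $X$ of $\varphi_1$. -/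

import Mathlib

/-! ### Graph realisations of matrices -/

namespace CombDMR

/-- `(G, Φ)` is a graph realisation of `D`: `Φ` is injective and the shortest-path distance of `G`
(with value `⊤` between different components) between the vertices `Φ i`, `Φ j` is `D i j`. -/
def IsRealisation {n : ℕ} {V : Type} (G : SimpleGraph V) (Φ : Fin n → V)
    (D : Matrix (Fin n) (Fin n) ℕ) : Prop :=
  Function.Injective Φ ∧ ∀ i j, G.edist (Φ i) (Φ j) = (D i j : ℕ∞)

/-- `D` is a YES-instance of the problem `k`-CombDMR: it has a graph realisation on at most
`n + k` vertices. -/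
def YesInstance (k : ℕ) {n : ℕ} (D : Matrix (Fin n) (Fin n) ℕ) : Prop :=
  ∃ (V : Type) (_ : Fintype V) (G : SimpleGraph V) (Φ : Fin n → V),
    Fintype.card V ≤ n + k ∧ IsRealisation G Φ D

/-- Distance matrices: zero exactly on the diagonal, symmetric, triangle inequality. -/
structure IsDistanceMatrix {n : ℕ} (D : Matrix (Fin n) (Fin n) ℕ) : Prop where
  diag : ∀ i, D i i = 0
  pos : ∀ i j, i ≠ j → 0 < D i j
  symm : ∀ i j, D i j = D j i
  triangle : ∀ i j w, D i j ≤ D i w + D w j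

/-! ### The `q`-skeleton -/

/-- The underlying graph of the `q`-skeleton of `D`: for `i < j` the pair `{i, j}` is an edge iff
`D i j ≤ q`. -/
def skeleton {n : ℕ} (D : Matrix (Fin n) (Fin n) ℕ) (q : ℕ) : SimpleGraph (Fin n) where
  Adj i j := (i < j ∧ D i j ≤ q) ∨ (j < i ∧ D j i ≤ q)
  symm := ⟨fun _ _ h => h.symm⟩
  loopless := ⟨fun i h => by rcases h with h | h <;> exact lt_irrefl i h.1⟩

/-- The length of a walk in the `q`-skeleton, the edge `{i, j}` having length `D i j`. -/
def walkLength {n : ℕ} (D : Matrix (Fin n) (Fin n) ℕ) {q : ℕ} {i j : Fin n}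
    (p : (skeleton D q).Walk i j) : ℕ :=
  (p.darts.map fun d => D d.fst d.snd).sum

/-- The distance matrix `D^(q)` of the `q`-skeleton: least length of a walk, `⊤` if there is none. -/
noncomputable def skeletonDist {n : ℕ} (D : Matrix (Fin n) (Fin n) ℕ) (q : ℕ) (i j : Fin n) : ℕ∞ :=
  ⨅ p : (skeleton D q).Walk i j, (walkLength D p : ℕ∞)

/-- The unweighted graph `G_D`, the `1`-skeleton without its weights. -/
def graphOf {n : ℕ} (D : Matrix (Fin n) (Fin n) ℕ) : SimpleGraph (Fin n) := skeleton D 1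

/-! ### 2-SAT and the instance `φ₁` -/

/-- A literal over the variables `α`. -/
inductive Literal (α : Type) : Type where
  /-- the variable `x` itself -/
  | pos (x : α) : Literal α
  /-- the negation of `x` -/
  | neg (x : α) : Literal α

/-- The truth value of a literal under an assignment. -/
def Literal.eval {α : Type} (X : α → Bool) : Literal α → Bool
  | .pos x => X x
  | .neg x => !X x

/-- A 2-CNF formula, as its set of clauses; the pair `(l, l')` stands for the clause `l ∨ l'`.
(Over a finite set of variables there are only finitely many clauses.) -/
abbrev TwoCNF (α : Type) : Type := Set (Literal α × Literal α)

/-- The assignment `X` satisfies the 2-CNF formula `φ`. -/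
def Satisfies {α : Type} (X : α → Bool) (φ : TwoCNF α) : Prop :=
  ∀ c ∈ φ, c.1.eval X = true ∨ c.2.eval X = true

/-- `r` is a correct answer to the 2-SAT instance `φ`: a satisfying assignment, or `none` when
there is no satisfying assignment. -/
def IsTwoSatAnswer {α : Type} (φ : TwoCNF α) (r : Option (α → Bool)) : Prop :=
  (∀ X, r = some X → Satisfies X φ) ∧ (r = none → ¬ ∃ X, Satisfies X φ)

/-- The 2-SAT instance `φ₁`. The variable `i` expresses that vertex `i` is adjacent to the extra
vertex. For `D i j > 2` there is the clause `¬ x_i ∨ ¬ x_j`; for `D i j = 2` with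
`d_{G_D}(i, j) > 2` there are the clauses `x_i ∨ x_i` and `x_j ∨ x_j`. -/
def phi₁ {n : ℕ} (D : Matrix (Fin n) (Fin n) ℕ) : TwoCNF (Fin n) :=
  {c | ∃ i j, 2 < D i j ∧ c = (.neg i, .neg j)} ∪
  {c | ∃ i j, D i j = 2 ∧ 2 < (graphOf D).edist i j ∧
    (c = (.pos i, .pos i) ∨ c = (.pos j, .pos j))}

/-- The graph `G_{φ₁,X}` on `n + 1` vertices: `G_D` on the first `n` vertices, the last vertex
being adjacent to exactly those `i` with `X i` true. -/
def extGraph {n : ℕ} (D : Matrix (Fin n) (Fin n) ℕ) (X : Fin n → Bool) :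
    SimpleGraph (Fin (n + 1)) where
  Adj a b :=
    (∃ i j, a = Fin.castSucc i ∧ b = Fin.castSucc j ∧ (graphOf D).Adj i j) ∨
    (∃ i, X i = true ∧ a = Fin.castSucc i ∧ b = Fin.last n) ∨
    (∃ i, X i = true ∧ a = Fin.last n ∧ b = Fin.castSucc i)
  symm := ⟨by
    rintro a b (⟨i, j, ha, hb, h⟩ | ⟨i, hX, ha, hb⟩ | ⟨i, hX, ha, hb⟩)
    · exact Or.inl ⟨j, i, hb, ha, h.symm⟩
    · exact Or.inr (Or.inr ⟨i, hX, hb, ha⟩)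
    · exact Or.inr (Or.inl ⟨i, hX, hb, ha⟩)⟩
  loopless := ⟨by
    rintro a (⟨i, j, ha, hb, h⟩ | ⟨i, hX, ha, hb⟩ | ⟨i, hX, ha, hb⟩)
    · exact h.ne (Fin.castSucc_injective n (ha.symm.trans hb))
    · exact (Fin.castSucc_lt_last i).ne (ha.symm.trans hb)
    · exact (Fin.castSucc_lt_last i).ne (hb.symm.trans ha)⟩

/-- The distance matrix `D(φ₁, X)` of `G_{φ₁,X}` over its first `n` vertices. -/
noncomputable def extDist {n : ℕ} (D : Matrix (Fin n) (Fin n) ℕ) (X : Fin n → Bool)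
    (i j : Fin n) : ℕ∞ :=
  (extGraph D X).edist i.castSucc j.castSucc

/-! ### The algorithm as a function, and the encodings of its inputs and outputs -/

/-- An input of the problem: a square matrix of non-negative integers. -/
abbrev Instance : Type := Σ n : ℕ, Matrix (Fin n) (Fin n) ℕ

/-- A candidate solution: for some `n`, a graph on `n + 1` vertices and a map of `n` labels to
its vertices. -/
abbrev Candidate : Type := Σ n : ℕ, SimpleGraph (Fin (n + 1)) × (Fin n → Fin (n + 1))

open Classical in
/-- The decision function of `k`-CombDMR. -/
noncomputable def decision (k : ℕ) (I : Instance) : Bool := decide (YesInstance k I.2)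

open Classical in
/-- The input-output behaviour of the algorithm, given the answers `solve` to the 2-SAT instances
`φ₁`: if `φ₁` has no solution, answer `none`; otherwise form `G_{φ₁,X}` and return it (with the
labels `i ↦ i`) if its distance matrix is `D`, and `none` if it is not. -/
noncomputable def algorithm
    (solve : (n : ℕ) → Matrix (Fin n) (Fin n) ℕ → Option (Fin n → Bool)) (I : Instance) :
    Option Candidate :=
  match solve I.1 I.2 with
  | none => none
  | some X =>
    if ∀ i j, extDist I.2 X i j = (I.2 i j : ℕ∞) then some ⟨I.1, extGraph I.2 X, Fin.castSucc⟩
    else none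

/-- The finite alphabet of inputs and outputs. -/
inductive Symbol : Type where
  | bit (b : Bool) : Symbol
  | comma : Symbol
  | semicolon : Symbol
  deriving DecidableEq, Fintype

/-- A matrix is written row by row; the entries are in binary, each followed by a comma, and each
row is followed by a semicolon. -/
def encodeInstance (I : Instance) : List Symbol :=
  (List.finRange I.1).flatMap fun i =>
    ((List.finRange I.1).flatMap fun j =>
      (Computability.encodeNat (I.2 i j)).map Symbol.bit ++ [Symbol.comma]) ++ [Symbol.semicolon]

open Classical in
/-- A candidate `(G, Φ)` is written as the adjacency matrix of `G`, each row followed by a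
semicolon, and then the vertex numbers `Φ i`, in unary, each followed by a comma. -/
noncomputable def encodeCandidate (c : Candidate) : List Symbol :=
  ((List.finRange (c.1 + 1)).flatMap fun a =>
    ((List.finRange (c.1 + 1)).map fun b => Symbol.bit (decide (c.2.1.Adj a b))) ++
      [Symbol.semicolon]) ++
  (List.finRange c.1).flatMap fun i =>
    List.replicate (c.2.2 i : ℕ) (Symbol.bit true) ++ [Symbol.comma]

/-- The answer "no" is written as `0`, and an answer `(G, Φ)` as `1` followed by its encoding. -/
noncomputable def encodeAnswer : Option Candidate → List Symbol
  | none => [Symbol.bit false]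
  | some c => Symbol.bit true :: encodeCandidate c

end CombDMR

/-!
Why the theorem holds.

*The algorithm.* If `D` is a distance matrix and `X` satisfies `φ₁`, then the graph `G_{φ₁,X}` has
the distances of the `2`-skeleton (`extDist_eq_skeletonDist`): the positive clauses make the extra
vertex a common neighbour of any `i`, `j` with `D i j = 2` that have no common neighbour in `G_D`,
and the negative clauses forbid a shortcut through the extra vertex between points of distance more
than `2`. In a realisation with at most `n + 1` vertices at most one vertex has no label, so a walk
between labelled vertices translates into a walk of the `2`-skeleton that is no longer
(`exists_walkLength_le`). Hence `D` agrees with `D^(2)` for a YES-instance `D`, and the vertex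
without a label yields a satisfying assignment (`YesInstance.exists_satisfies`).

*The choice of the assignments.* All clauses of `φ₁` are Horn clauses. The least assignment that
satisfies the positive clauses therefore satisfies `φ₁` if anything does
(`isTwoSatAnswer_leastSolve`), and no general 2-SAT solver is needed.

*The running time.* Being a YES-instance is equivalent to a property `IsGood D`, which quantifies
over indices and compares sums of entries (`yesInstance_iff_isGood`); the least assignment has a
description of the same kind (`leastAssignment_eq_true`). Such properties are written in a small
language of expressions (`Expr`), whose atoms are the bits of the entries and whose loops run over
indices and bit positions, with values from a finite set; a second language (`Printer`) describes
the output. Both are compiled to structured programs for stack machines (`Cmd`) and these to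
Mathlib's machines `Turing.FinTM2` (`Cmd.Exec.steps`). Every loop is bounded by the length of the
input, so that a polynomial bound for the running time can be read off from an expression
(`Expr.does_compile`, `Printer.does_compile`, `Printer.exists_polyTime`).
-/

open Computability

namespace CombDMR

/-! ### Walks in a realisation and walks in the `2`-skeleton -/

theorem skeleton_adj_of_le {n : ℕ} {D : Matrix (Fin n) (Fin n) ℕ} {q : ℕ} {i j : Fin n}
    (hij : i ≠ j) (h : D i j ≤ q) (h' : D j i ≤ q) : (skeleton D q).Adj i j := by
  rcases lt_or_gt_of_ne hij with hlt | hlt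
  · exact Or.inl ⟨hlt, h⟩
  · exact Or.inr ⟨hlt, h'⟩

@[simp]
theorem walkLength_nil {n : ℕ} (D : Matrix (Fin n) (Fin n) ℕ) (q : ℕ) (i : Fin n) :
    walkLength D (SimpleGraph.Walk.nil : (skeleton D q).Walk i i) = 0 := rfl

@[simp]
theorem walkLength_cons {n : ℕ} (D : Matrix (Fin n) (Fin n) ℕ) {q : ℕ} {i j k : Fin n}
    (h : (skeleton D q).Adj i j) (p : (skeleton D q).Walk j k) :
    walkLength D (SimpleGraph.Walk.cons h p) = D i j + walkLength D p := by
  simp [walkLength]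

/-- If the vertices outside the range of `φ` are pairwise non-adjacent, a walk between labelled
vertices becomes a walk of the `2`-skeleton that is no longer: a visit to an outside vertex is
replaced by an edge of length at most `2`. -/
theorem exists_walkLength_le {n : ℕ} {D : Matrix (Fin n) (Fin n) ℕ} {V : Type}
    {G : SimpleGraph V} {φ : Fin n → V}
    (hone : ∀ i k, G.Adj (φ i) (φ k) → i ≠ k ∧ D i k ≤ 1)
    (htwo : ∀ i k o, i ≠ k → G.Adj (φ i) o → G.Adj (φ k) o → D i k ≤ 2)
    (hout : ∀ o o', G.Adj o o' → (∃ k, φ k = o) ∨ ∃ k, φ k = o')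
    (hinj : Function.Injective φ) {i j : Fin n} (w : G.Walk (φ i) (φ j)) :
    ∃ p : (skeleton D 2).Walk i j, walkLength D p ≤ w.length := by
  suffices H : ∀ {a b : V} (w : G.Walk a b) (j : Fin n), b = φ j →
      (∀ i, a = φ i → ∃ p : (skeleton D 2).Walk i j, walkLength D p ≤ w.length) ∧
      ((¬ ∃ k, φ k = a) → ∀ i, G.Adj (φ i) a →
        ∃ p : (skeleton D 2).Walk i j, walkLength D p ≤ w.length + 1) from
    (H w j rfl).1 i rfl
  intro a b w
  induction w with
  | nil =>
    intro j hb
    refine ⟨fun i hi => ?_, fun ha => absurd ⟨j, hb.symm⟩ ha⟩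
    obtain rfl : i = j := hinj (hi.symm.trans hb)
    exact ⟨.nil, by simp⟩
  | @cons a u b h w ih =>
    intro j hb
    obtain ⟨ih1, ih2⟩ := ih j hb
    constructor
    · rintro i rfl
      by_cases hu : ∃ k, φ k = u
      · obtain ⟨k, rfl⟩ := hu
        obtain ⟨p, hp⟩ := ih1 k rfl
        obtain ⟨hne, h1⟩ := hone i k h
        have h1' := (hone k i h.symm).2
        refine ⟨.cons (skeleton_adj_of_le hne (by omega) (by omega)) p, ?_⟩
        simp only [walkLength_cons, SimpleGraph.Walk.length_cons]
        omega
      · obtain ⟨p, hp⟩ := ih2 hu i h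
        exact ⟨p, by simpa using hp⟩
    · intro ha i hi
      obtain ⟨k, rfl⟩ : ∃ k, φ k = u := (hout _ _ h).resolve_left ha
      obtain ⟨p, hp⟩ := ih1 k rfl
      by_cases hik : i = k
      · subst hik
        exact ⟨p, by simp only [SimpleGraph.Walk.length_cons]; omega⟩
      · have h2 := htwo i k a hik hi h.symm
        refine ⟨.cons (skeleton_adj_of_le hik h2 (htwo k i a (Ne.symm hik) h.symm hi)) p, ?_⟩
        simp only [walkLength_cons, SimpleGraph.Walk.length_cons]
        omega

/-- By the triangle inequality, walks of a skeleton are never too short. -/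
theorem IsDistanceMatrix.le_walkLength {n : ℕ} {D : Matrix (Fin n) (Fin n) ℕ}
    (hD : IsDistanceMatrix D) {q : ℕ} {i j : Fin n} (p : (skeleton D q).Walk i j) :
    D i j ≤ walkLength D p := by
  induction p with
  | nil => simp [hD.diag]
  | @cons i k j h p ih =>
    rw [walkLength_cons]
    exact (hD.triangle i j k).trans (by omega)

/-- To compute a skeleton distance, one walk of the right length suffices: by the triangle
inequality no walk is shorter than the entry of `D`. -/
theorem skeletonDist_eq {n : ℕ} {D : Matrix (Fin n) (Fin n) ℕ} (hD : IsDistanceMatrix D)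
    {q : ℕ} {i j : Fin n} (h : ∃ p : (skeleton D q).Walk i j, walkLength D p ≤ D i j) :
    skeletonDist D q i j = D i j := by
  obtain ⟨p, hp⟩ := h
  refine le_antisymm ((iInf_le _ p).trans (by exact_mod_cast hp)) (le_iInf fun p => ?_)
  exact_mod_cast hD.le_walkLength p

/-! ### The graph of a satisfying assignment -/

theorem graphOf_adj {n : ℕ} {D : Matrix (Fin n) (Fin n) ℕ} (hD : IsDistanceMatrix D)
    {i j : Fin n} : (graphOf D).Adj i j ↔ D i j = 1 := by
  constructor
  · intro h
    have h0 := hD.pos i j h.ne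
    have hs := hD.symm i j
    rcases h with ⟨-, h⟩ | ⟨-, h⟩ <;> omega
  · intro h
    refine skeleton_adj_of_le ?_ h.le (hD.symm j i ▸ h.le)
    rintro rfl
    simp [hD.diag] at h

@[simp]
theorem extGraph_adj_castSucc {n : ℕ} {D : Matrix (Fin n) (Fin n) ℕ} {X : Fin n → Bool}
    {i j : Fin n} : (extGraph D X).Adj i.castSucc j.castSucc ↔ (graphOf D).Adj i j := by
  constructor
  · rintro (⟨i', j', hi, hj, h⟩ | ⟨i', _, _, h⟩ | ⟨i', _, h, _⟩)
    · rwa [Fin.castSucc_injective n hi, Fin.castSucc_injective n hj]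
    · exact absurd h (Fin.castSucc_lt_last j).ne
    · exact absurd h (Fin.castSucc_lt_last i).ne
  · exact fun h => Or.inl ⟨i, j, rfl, rfl, h⟩

@[simp]
theorem extGraph_adj_last {n : ℕ} {D : Matrix (Fin n) (Fin n) ℕ} {X : Fin n → Bool}
    {i : Fin n} : (extGraph D X).Adj i.castSucc (Fin.last n) ↔ X i = true := by
  constructor
  · rintro (⟨i', j', hi, hj, h⟩ | ⟨i', hX, h, _⟩ | ⟨i', _, h, _⟩)
    · exact absurd hj.symm (Fin.castSucc_lt_last j').ne
    · rwa [Fin.castSucc_injective n h]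
    · exact absurd h (Fin.castSucc_lt_last i).ne
  · exact fun h => Or.inr (Or.inl ⟨i, h, rfl, rfl⟩)

theorem edist_le_two_of_adj {V : Type} {G : SimpleGraph V} {a b c : V} (h : G.Adj a b)
    (h' : G.Adj b c) : G.edist a c ≤ 2 := by
  simpa using SimpleGraph.edist_le (.cons h (.cons h' .nil))

theorem exists_common_neighbor {V : Type} {G : SimpleGraph V} {a b : V}
    (h : G.edist a b = 2) : ∃ c, G.Adj a c ∧ G.Adj c b := by
  obtain ⟨w, hw⟩ := SimpleGraph.exists_walk_of_edist_ne_top (G := G) (u := a) (v := b)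
    (by rw [h]; exact ENat.natCast_ne_top 2)
  rw [h] at hw
  have hw : w.length = 2 := by exact_mod_cast hw
  match w, hw with
  | .cons h1 (.cons h2 .nil), _ => exact ⟨_, h1, h2⟩

theorem Satisfies.not_and {n : ℕ} {D : Matrix (Fin n) (Fin n) ℕ} {X : Fin n → Bool}
    (hX : Satisfies X (phi₁ D)) {i j : Fin n} (h : 2 < D i j) : ¬ (X i = true ∧ X j = true) := by
  rintro ⟨hi, hj⟩
  have := hX (.neg i, .neg j) (Or.inl ⟨i, j, h, rfl⟩)
  simp [Literal.eval, hi, hj] at this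

theorem Satisfies.and {n : ℕ} {D : Matrix (Fin n) (Fin n) ℕ} {X : Fin n → Bool}
    (hX : Satisfies X (phi₁ D)) {i j : Fin n} (h : D i j = 2) (h' : 2 < (graphOf D).edist i j) :
    X i = true ∧ X j = true := by
  have hi := hX (.pos i, .pos i) (Or.inr ⟨i, j, h, h', Or.inl rfl⟩)
  have hj := hX (.pos j, .pos j) (Or.inr ⟨i, j, h, h', Or.inr rfl⟩)
  exact ⟨by simpa [Literal.eval] using hi, by simpa [Literal.eval] using hj⟩

/-- The graph of any satisfying assignment has the distances of the `2`-skeleton. The positive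
clauses make every edge of length `2` available; the negative ones prevent shortcuts. -/
theorem extDist_eq_skeletonDist {n : ℕ} {D : Matrix (Fin n) (Fin n) ℕ} (hD : IsDistanceMatrix D)
    {X : Fin n → Bool} (hX : Satisfies X (phi₁ D)) (i j : Fin n) :
    extDist D X i j = skeletonDist D 2 i j := by
  apply le_antisymm
  · refine le_iInf fun p => ?_
    unfold extDist
    induction p with
    | nil => simp
    | @cons i k j h p ih =>
      rw [walkLength_cons, Nat.cast_add]
      refine SimpleGraph.edist_triangle.trans (add_le_add ?_ ih)
      have hpos := hD.pos i k h.ne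
      have hle : D i k ≤ 2 := by
        have hs := hD.symm i k
        rcases h with ⟨-, h⟩ | ⟨-, h⟩ <;> omega
      obtain h1 | h2 : D i k = 1 ∨ D i k = 2 := by omega
      · rw [h1]
        exact (SimpleGraph.edist_eq_one_iff_adj.2
          (extGraph_adj_castSucc.2 ((graphOf_adj hD).2 h1))).le
      · rw [h2]
        by_cases hd : 2 < (graphOf D).edist i k
        · obtain ⟨hi, hk⟩ := hX.and h2 hd
          exact edist_le_two_of_adj (extGraph_adj_last.2 hi) (extGraph_adj_last.2 hk).symm
        · rw [not_lt] at hd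
          obtain ⟨w, hw⟩ := SimpleGraph.exists_walk_of_edist_ne_top (G := graphOf D)
            (u := i) (v := k) (ne_top_of_le_ne_top (ENat.natCast_ne_top 2) hd)
          let f : graphOf D →g extGraph D X := ⟨Fin.castSucc, extGraph_adj_castSucc.2⟩
          have := SimpleGraph.edist_le (w.map f)
          rw [SimpleGraph.Walk.length_map, hw] at this
          exact this.trans hd
  · refine le_iInf fun w => ?_
    have hp : ∃ p : (skeleton D 2).Walk i j, walkLength D p ≤ w.length := by
      refine exists_walkLength_le (fun i k h => ?_) (fun i k o hik hi hk => ?_) (fun o o' h => ?_)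
        (Fin.castSucc_injective n) w
      · have h := extGraph_adj_castSucc.1 h
        exact ⟨h.ne, ((graphOf_adj hD).1 h).le⟩
      · induction o using Fin.lastCases with
        | last =>
          by_contra hlt
          exact hX.not_and (not_le.1 hlt) ⟨extGraph_adj_last.1 hi, extGraph_adj_last.1 hk⟩
        | cast o =>
          have hi := (graphOf_adj hD).1 (extGraph_adj_castSucc.1 hi)
          have hk := (graphOf_adj hD).1 (extGraph_adj_castSucc.1 hk)
          have h1 := hD.triangle i k o
          have h2 := hD.symm k o
          omega
      · induction o using Fin.lastCases with
        | last =>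
          induction o' using Fin.lastCases with
          | last => exact absurd rfl h.ne
          | cast o' => exact Or.inr ⟨o', rfl⟩
        | cast o => exact Or.inl ⟨o, rfl⟩
    obtain ⟨p, hp⟩ := hp
    exact (iInf_le _ p).trans (by exact_mod_cast hp)

/-! ### YES-instances -/

theorem IsRealisation.isDistanceMatrix {n : ℕ} {D : Matrix (Fin n) (Fin n) ℕ} {V : Type}
    {G : SimpleGraph V} {Φ : Fin n → V} (h : IsRealisation G Φ D) : IsDistanceMatrix D where
  diag i := by
    have := h.2 i i
    rw [SimpleGraph.edist_self] at this
    exact_mod_cast this.symm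
  pos i j hij := by
    rw [Nat.pos_iff_ne_zero]
    intro h0
    have := h.2 i j
    rw [h0, Nat.cast_zero, SimpleGraph.edist_eq_zero_iff] at this
    exact hij (h.1 this)
  symm i j := by
    have := h.2 i j
    rw [SimpleGraph.edist_comm, h.2 j i] at this
    exact_mod_cast this.symm
  triangle i j w := by
    have := SimpleGraph.edist_triangle (G := G) (u := Φ i) (v := Φ w) (w := Φ j)
    rw [h.2, h.2, h.2] at this
    exact_mod_cast this

theorem IsRealisation.adj_iff {n : ℕ} {D : Matrix (Fin n) (Fin n) ℕ} {V : Type}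
    {G : SimpleGraph V} {Φ : Fin n → V} (h : IsRealisation G Φ D) {i j : Fin n} :
    G.Adj (Φ i) (Φ j) ↔ D i j = 1 := by
  rw [← SimpleGraph.edist_eq_one_iff_adj, h.2]
  norm_cast

/-- With at most `n + 1` vertices there is at most one vertex without a label. -/
theorem eq_of_notMem_range {n : ℕ} {V : Type} [Fintype V] (hV : Fintype.card V ≤ n + 1)
    {Φ : Fin n → V} (hΦ : Function.Injective Φ) {u w : V} (hu : ¬ ∃ k, Φ k = u)
    (hw : ¬ ∃ k, Φ k = w) : u = w := by
  classical
  by_contra huw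
  have h1 : (insert u (insert w (Finset.univ.image Φ))).card = n + 2 := by
    rw [Finset.card_insert_of_notMem, Finset.card_insert_of_notMem,
      Finset.card_image_of_injective _ hΦ, Finset.card_univ, Fintype.card_fin]
    · simpa using hw
    · simpa [huw] using hu
  have h2 := Finset.card_le_univ (insert u (insert w (Finset.univ.image Φ)))
  omega

/-- A YES-instance makes `φ₁` satisfiable: let `x_i` say that `Φ i` is adjacent to a vertex without
a label. -/
theorem YesInstance.exists_satisfies {n : ℕ} {D : Matrix (Fin n) (Fin n) ℕ}
    (h : YesInstance 1 D) : ∃ X, Satisfies X (phi₁ D) := by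
  classical
  obtain ⟨V, _, G, Φ, hV, hG⟩ := h
  have hD := hG.isDistanceMatrix
  refine ⟨fun i => decide (∃ w, (¬ ∃ k, Φ k = w) ∧ G.Adj (Φ i) w), ?_⟩
  rintro c (⟨i, j, hij, rfl⟩ | ⟨i, j, hij, hd, hc⟩)
  · by_contra hcon
    simp only [Literal.eval, Bool.not_eq_true', decide_eq_false_iff_not, not_or, not_not] at hcon
    obtain ⟨⟨u, hu, hiu⟩, w, hw, hjw⟩ := hcon
    obtain rfl := eq_of_notMem_range hV hG.1 hu hw
    have := edist_le_two_of_adj hiu hjw.symm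
    rw [hG.2] at this
    exact absurd (by exact_mod_cast this) (not_le.2 hij)
  · obtain ⟨c', h1, h2⟩ := exists_common_neighbor (G := G) (a := Φ i) (b := Φ j)
      (by rw [hG.2, hij]; rfl)
    have hc' : ¬ ∃ k, Φ k = c' := by
      rintro ⟨k, rfl⟩
      exact absurd (edist_le_two_of_adj ((graphOf_adj hD).2 (hG.adj_iff.1 h1))
        ((graphOf_adj hD).2 (hG.adj_iff.1 h2))) (not_le.2 hd)
    rcases hc with rfl | rfl
    · exact Or.inl (decide_eq_true ⟨c', hc', h1⟩)
    · exact Or.inl (decide_eq_true ⟨c', hc', h2.symm⟩)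

theorem YesInstance.isDistanceMatrix {k n : ℕ} {D : Matrix (Fin n) (Fin n) ℕ}
    (h : YesInstance k D) : IsDistanceMatrix D := by
  obtain ⟨V, _, G, Φ, -, hG⟩ := h
  exact hG.isDistanceMatrix

/-- The entries of a YES-instance are attained by walks of the `2`-skeleton. -/
theorem YesInstance.exists_walk {n : ℕ} {D : Matrix (Fin n) (Fin n) ℕ}
    (h : YesInstance 1 D) (i j : Fin n) :
    ∃ p : (skeleton D 2).Walk i j, walkLength D p ≤ D i j := by
  obtain ⟨V, _, G, Φ, hV, hG⟩ := h
  obtain ⟨w, hw⟩ := SimpleGraph.exists_walk_of_edist_ne_top (G := G) (u := Φ i) (v := Φ j)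
    (by rw [hG.2]; exact ENat.natCast_ne_top _)
  have hw : w.length = D i j := by rw [hG.2] at hw; exact_mod_cast hw
  rw [← hw]
  refine exists_walkLength_le (fun i k h => ?_) (fun i k o hik hi hk => ?_) (fun o o' h => ?_)
    hG.1 w
  · refine ⟨?_, (hG.adj_iff.1 h).le⟩
    rintro rfl
    exact h.ne rfl
  · have := edist_le_two_of_adj hi hk.symm
    rw [hG.2] at this
    exact_mod_cast this
  · by_contra hcon
    rw [not_or] at hcon
    exact h.ne (eq_of_notMem_range hV hG.1 hcon.1 hcon.2)

theorem YesInstance.extDist_eq {n : ℕ} {D : Matrix (Fin n) (Fin n) ℕ}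
    (h : YesInstance 1 D) {X : Fin n → Bool} (hX : Satisfies X (phi₁ D)) (i j : Fin n) :
    extDist D X i j = D i j := by
  rw [extDist_eq_skeletonDist h.isDistanceMatrix hX,
    skeletonDist_eq h.isDistanceMatrix (h.exists_walk i j)]

theorem isRealisation_extGraph {n : ℕ} {D : Matrix (Fin n) (Fin n) ℕ} {X : Fin n → Bool}
    (h : ∀ i j, extDist D X i j = D i j) : IsRealisation (extGraph D X) Fin.castSucc D :=
  ⟨Fin.castSucc_injective n, h⟩

theorem yesInstance_of_extDist {n : ℕ} {D : Matrix (Fin n) (Fin n) ℕ} {X : Fin n → Bool}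
    (h : ∀ i j, extDist D X i j = D i j) : YesInstance 1 D :=
  ⟨Fin (n + 1), inferInstance, _, _, by simp, isRealisation_extGraph h⟩

theorem algorithm_eq_some {solve : (n : ℕ) → Matrix (Fin n) (Fin n) ℕ → Option (Fin n → Bool)}
    (hsolve : ∀ (n : ℕ) (D : Matrix (Fin n) (Fin n) ℕ), IsTwoSatAnswer (phi₁ D) (solve n D))
    {n : ℕ} {D : Matrix (Fin n) (Fin n) ℕ} (h : YesInstance 1 D) :
    ∃ X, solve n D = some X ∧ Satisfies X (phi₁ D) ∧
      algorithm solve ⟨n, D⟩ = some ⟨n, extGraph D X, Fin.castSucc⟩ := by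
  rcases hs : solve n D with - | X
  · exact absurd h.exists_satisfies ((hsolve n D).2 hs)
  · have hX := (hsolve n D).1 X hs
    refine ⟨X, rfl, hX, ?_⟩
    simp only [algorithm, hs]
    exact if_pos (h.extDist_eq hX)

theorem algorithm_eq_none {solve : (n : ℕ) → Matrix (Fin n) (Fin n) ℕ → Option (Fin n → Bool)}
    {n : ℕ} {D : Matrix (Fin n) (Fin n) ℕ} (h : ¬ YesInstance 1 D) :
    algorithm solve ⟨n, D⟩ = none := by
  rcases hs : solve n D with - | X
  · simp only [algorithm, hs]
  · simp only [algorithm, hs]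
    exact if_neg fun hX => h (yesInstance_of_extDist hX)

/-! ### The least assignment, and a first-order description of the YES-instances -/

open Classical in
/-- The least assignment satisfying the positive clauses of `φ₁`. -/
noncomputable def leastAssignment {n : ℕ} (D : Matrix (Fin n) (Fin n) ℕ) (i : Fin n) : Bool :=
  decide ((Literal.pos i, Literal.pos i) ∈ phi₁ D)

open Classical in
/-- The answer to the 2-SAT instance `φ₁` by its least assignment. -/
noncomputable def leastSolve (n : ℕ) (D : Matrix (Fin n) (Fin n) ℕ) : Option (Fin n → Bool) :=
  if Satisfies (leastAssignment D) (phi₁ D) then some (leastAssignment D) else none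

theorem leastAssignment_eq_true_iff_mem {n : ℕ} {D : Matrix (Fin n) (Fin n) ℕ} {i : Fin n} :
    leastAssignment D i = true ↔ (Literal.pos i, Literal.pos i) ∈ phi₁ D := by
  simp [leastAssignment]

theorem Satisfies.of_leastAssignment {n : ℕ} {D : Matrix (Fin n) (Fin n) ℕ} {X : Fin n → Bool}
    (hX : Satisfies X (phi₁ D)) {i : Fin n} (h : leastAssignment D i = true) : X i = true := by
  simpa [Literal.eval] using hX _ (leastAssignment_eq_true_iff_mem.1 h)

/-- All clauses of `φ₁` are Horn clauses: every satisfying assignment contains the least one, and the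
negative clauses are inherited by smaller assignments. -/
theorem isTwoSatAnswer_leastSolve (n : ℕ) (D : Matrix (Fin n) (Fin n) ℕ) :
    IsTwoSatAnswer (phi₁ D) (leastSolve n D) := by
  unfold leastSolve
  split_ifs with h
  · refine ⟨?_, by simp⟩
    rintro X hX
    rwa [← Option.some_injective _ hX]
  · refine ⟨by simp, fun _ ⟨X, hX⟩ => h ?_⟩
    intro c hc
    rcases id hc with ⟨i, j, hij, rfl⟩ | ⟨i, j, hij, hd, rfl | rfl⟩
    · by_contra hcon
      simp only [Literal.eval, Bool.not_eq_true', not_or, Bool.not_eq_false] at hcon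
      exact hX.not_and hij ⟨hX.of_leastAssignment hcon.1, hX.of_leastAssignment hcon.2⟩
    · exact Or.inl (leastAssignment_eq_true_iff_mem.2 hc)
    · exact Or.inl (leastAssignment_eq_true_iff_mem.2 hc)

/-- For a distance matrix, the variables in positive clauses of `φ₁`: those `i` that have an entry
`2` in their row which is not explained by a common neighbour in `G_D`. -/
def IsForced {n : ℕ} (D : Matrix (Fin n) (Fin n) ℕ) (i : Fin n) : Prop :=
  ∃ j, D i j = 2 ∧ ¬ ∃ k, D i k = 1 ∧ D k j = 1

theorem two_lt_edist_graphOf {n : ℕ} {D : Matrix (Fin n) (Fin n) ℕ} (hD : IsDistanceMatrix D)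
    {i j : Fin n} (hij : D i j = 2) :
    2 < (graphOf D).edist i j ↔ ¬ ∃ k, D i k = 1 ∧ D k j = 1 := by
  constructor
  · rintro h ⟨k, h1, h2⟩
    exact absurd (edist_le_two_of_adj ((graphOf_adj hD).2 h1) ((graphOf_adj hD).2 h2))
      (not_le.2 h)
  · intro h
    by_contra hle
    rw [not_lt] at hle
    obtain ⟨w, hw⟩ := SimpleGraph.exists_walk_of_edist_ne_top (G := graphOf D)
      (u := i) (v := j) (ne_top_of_le_ne_top (ENat.natCast_ne_top 2) hle)
    have hw : w.length ≤ 2 := by rw [← hw] at hle; exact_mod_cast hle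
    match w, hw with
    | .nil, _ => simp [hD.diag] at hij
    | .cons h1 .nil, _ => rw [(graphOf_adj hD).1 h1] at hij; omega
    | .cons h1 (.cons h2 .nil), _ =>
      exact h ⟨_, (graphOf_adj hD).1 h1, (graphOf_adj hD).1 h2⟩

theorem leastAssignment_eq_true {n : ℕ} {D : Matrix (Fin n) (Fin n) ℕ} (hD : IsDistanceMatrix D)
    {i : Fin n} : leastAssignment D i = true ↔ IsForced D i := by
  rw [leastAssignment_eq_true_iff_mem]
  constructor
  · rintro (⟨_, _, _, h⟩ | ⟨i', j, hij, hd, h⟩)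
    · simp at h
    · have hd' := (two_lt_edist_graphOf hD hij).1 hd
      simp only [Prod.mk.injEq, and_self, Literal.pos.injEq] at h
      rcases h with rfl | rfl
      · exact ⟨j, hij, hd'⟩
      · refine ⟨i', hD.symm _ _ ▸ hij, fun ⟨k, h1, h2⟩ => hd' ⟨k, ?_, ?_⟩⟩
        · rwa [hD.symm]
        · rwa [hD.symm]
  · rintro ⟨j, hij, hd⟩
    exact Or.inr ⟨i, j, hij, (two_lt_edist_graphOf hD hij).2 hd, Or.inl rfl⟩

/-- A description of the YES-instances that mentions only comparisons of entries and sums of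
entries of `D`. -/
structure IsGood {n : ℕ} (D : Matrix (Fin n) (Fin n) ℕ) : Prop where
  isDistanceMatrix : IsDistanceMatrix D
  not_forced : ∀ i j, 2 < D i j → ¬ (IsForced D i ∧ IsForced D j)
  split : ∀ i j, 2 < D i j → ∃ k, (D i k = 1 ∨ D i k = 2) ∧ D i j = D i k + D k j

theorem IsGood.exists_walk {n : ℕ} {D : Matrix (Fin n) (Fin n) ℕ} (h : IsGood D) (i j : Fin n) :
    ∃ p : (skeleton D 2).Walk i j, walkLength D p ≤ D i j := by
  have hD := h.isDistanceMatrix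
  have hcons : ∀ {i k}, i ≠ k → D i k ≤ 2 → (skeleton D 2).Adj i k := fun hik hle =>
    skeleton_adj_of_le hik hle (hD.symm _ _ ▸ hle)
  induction hd : D i j using Nat.strong_induction_on generalizing i with
  | _ d ih =>
    by_cases hij : i = j
    · subst hij
      exact ⟨.nil, by simp⟩
    · by_cases hle : D i j ≤ 2
      · exact ⟨.cons (hcons hij hle) .nil, by simp [hd]⟩
      · obtain ⟨k, hk, hs⟩ := h.split i j (not_le.1 hle)
        have hik : i ≠ k := by
          rintro rfl
          simp [hD.diag] at hk
        obtain ⟨p, hp⟩ := ih (D k j) (by omega) k rfl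
        exact ⟨.cons (hcons hik (by omega)) p, by rw [walkLength_cons]; omega⟩

/-- The YES-instances are the good matrices. From a walk of the `2`-skeleton of length `D i j` one
reads off the splitting of `D i j` at its first edge; conversely, repeated splitting produces such
walks, and the least assignment gives a realisation. -/
theorem yesInstance_iff_isGood {n : ℕ} {D : Matrix (Fin n) (Fin n) ℕ} :
    YesInstance 1 D ↔ IsGood D := by
  constructor
  · intro h
    have hD := h.isDistanceMatrix
    refine ⟨hD, fun i j hij hf => ?_, fun i j hij => ?_⟩
    · obtain ⟨X, hX⟩ := h.exists_satisfies
      exact hX.not_and hij ⟨hX.of_leastAssignment ((leastAssignment_eq_true hD).2 hf.1),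
        hX.of_leastAssignment ((leastAssignment_eq_true hD).2 hf.2)⟩
    · obtain ⟨p, hp⟩ := h.exists_walk i j
      match p, hp with
      | .nil, _ => simp [hD.diag] at hij
      | .cons (v := k) hik p, hp =>
        rw [walkLength_cons] at hp
        have h1 := hD.le_walkLength p
        have h2 := hD.triangle i j k
        have h3 := hD.pos i k hik.ne
        have h4 := hD.symm i k
        have h5 : D i k ≤ 2 := by rcases hik with ⟨-, h⟩ | ⟨-, h⟩ <;> omega
        exact ⟨k, by omega, by omega⟩
  · intro h
    have hD := h.isDistanceMatrix
    have hX : Satisfies (leastAssignment D) (phi₁ D) := by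
      intro c hc
      rcases id hc with ⟨i, j, hij, rfl⟩ | ⟨i, j, hij, hd, rfl | rfl⟩
      · by_contra hcon
        simp only [Literal.eval, Bool.not_eq_true', not_or, Bool.not_eq_false,
          leastAssignment_eq_true hD] at hcon
        exact h.not_forced i j hij hcon
      · exact Or.inl (leastAssignment_eq_true_iff_mem.2 hc)
      · exact Or.inl (leastAssignment_eq_true_iff_mem.2 hc)
    refine yesInstance_of_extDist (X := leastAssignment D) fun i j => ?_
    rw [extDist_eq_skeletonDist hD hX, skeletonDist_eq hD (h.exists_walk i j)]

/-! ### A structured language for stack machines -/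

/-- Structured programs for a machine with stacks `k : K` over the alphabets `Γ k`. There are no
variables besides the stacks: control flow depends only on the top symbol of a stack. -/
inductive Cmd {K : Type} (Γ : K → Type) : Type
  /-- push `x` onto the stack `k` -/
  | push (k : K) (x : Γ k)
  /-- remove the top of the stack `k`, if there is one -/
  | drop (k : K)
  /-- run two programs, one after the other -/
  | seq (c d : Cmd Γ)
  /-- choose the program to run by the top of the stack `k` (`none` if it is empty) -/
  | choose (k : K) (f : Option (Γ k) → Cmd Γ)
  /-- repeat a program as long as the top of the stack `k` satisfies `p` -/
  | loop (k : K) (p : Option (Γ k) → Bool) (c : Cmd Γ)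

namespace Cmd

variable {K : Type} {Γ : K → Type}

/-- The program points of a program. -/
def Label : Cmd Γ → Type
  | push _ _ => Unit
  | drop _ => Unit
  | seq c d => c.Label ⊕ d.Label
  | choose _ f => Option (Σ o, (f o).Label)
  | loop _ _ c => Option c.Label

/-- The program point at which a program starts. -/
def entry : (c : Cmd Γ) → c.Label
  | push _ _ => ()
  | drop _ => ()
  | seq c _ => Sum.inl c.entry
  | choose _ _ => none
  | loop _ _ _ => none

instance finite_label [∀ k, Finite (Γ k)] : (c : Cmd Γ) → Finite c.Label
  | push _ _ => inferInstanceAs (Finite Unit)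
  | drop _ => inferInstanceAs (Finite Unit)
  | seq c d =>
    haveI := finite_label c
    haveI := finite_label d
    inferInstanceAs (Finite (c.Label ⊕ d.Label))
  | choose _ f =>
    haveI := fun o => finite_label (f o)
    inferInstanceAs (Finite (Option (Σ o, (f o).Label)))
  | loop _ _ c =>
    haveI := finite_label c
    inferInstanceAs (Finite (Option c.Label))

variable [DecidableEq K]

/-- `Exec c S S' t`: started with stacks `S`, the program `c` ends with stacks `S'` after `t` steps
of the machine. -/
inductive Exec : Cmd Γ → (∀ k, List (Γ k)) → (∀ k, List (Γ k)) → ℕ → Prop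
  | push (k x S) : Exec (push k x) S (Function.update S k (x :: S k)) 1
  | drop (k S) : Exec (drop k) S (Function.update S k (S k).tail) 1
  | seq {c d S S' S'' t t'} : Exec c S S' t → Exec d S' S'' t' → Exec (seq c d) S S'' (t + t')
  | choose {k f S S' t} : Exec (f (S k).head?) S S' t → Exec (choose k f) S S' (t + 1)
  | loop_false {k p c S} : p (S k).head? = false → Exec (loop k p c) S S 1
  | loop_true {k p c S S' S'' t t'} : p (S k).head? = true → Exec c S S' t →
      Exec (loop k p c) S' S'' t' → Exec (loop k p c) S S'' (t + t' + 1)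

/-- The machine code of a program: `emb` places its program points among the labels of the whole
machine, and `next` is the label to go to at its end. The internal state of the machine holds the
symbol seen last on each stack; it is used only to pass on the result of a `peek`. -/
def code {Λ : Type} : (c : Cmd Γ) → (c.Label → Λ) → Λ → c.Label →
    Turing.TM2.Stmt Γ Λ (∀ k, Option (Γ k))
  | push k x, _, next, _ => .push k (fun _ => x) (.goto fun _ => next)
  | drop k, _, next, _ => .pop k (fun v _ => v) (.goto fun _ => next)
  | seq c d, emb, _, Sum.inl l => code c (emb ∘ Sum.inl) (emb (Sum.inr d.entry)) l
  | seq _ d, emb, next, Sum.inr l => code d (emb ∘ Sum.inr) next l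
  | choose k f, emb, _, none =>
    .peek k (fun v o => Function.update v k o) (.goto fun v => emb (some ⟨v k, (f (v k)).entry⟩))
  | choose _ f, emb, next, some ⟨o, l⟩ => code (f o) (fun l => emb (some ⟨o, l⟩)) next l
  | loop k p c, emb, next, none =>
    .peek k (fun v o => Function.update v k o)
      (.goto fun v => cond (p (v k)) (emb (some c.entry)) next)
  | loop _ _ c, emb, _, some l => code c (emb ∘ some) (emb none) l

theorem flip_bind_step {Λ σ : Type} (M : Λ → Turing.TM2.Stmt Γ Λ σ) (c : Turing.TM2.Cfg Γ Λ σ) :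
    flip bind (Turing.TM2.step M) (some c) = Turing.TM2.step M c := rfl

/-- The machine code is correct, and takes exactly as many steps as `Exec` says. -/
theorem Exec.steps {c : Cmd Γ} {S S' : ∀ k, List (Γ k)} {t : ℕ} (h : Exec c S S' t) {Λ : Type}
    {M : Λ → Turing.TM2.Stmt Γ Λ (∀ k, Option (Γ k))} {emb : c.Label → Λ} {next : Λ}
    (hM : ∀ l, M (emb l) = c.code emb next l) (v : ∀ k, Option (Γ k)) :
    ∃ v', (flip bind (Turing.TM2.step M))^[t] (some ⟨some (emb c.entry), v, S⟩) =
      some ⟨some next, v', S'⟩ := by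
  induction h generalizing next v with
  | push k x S =>
    refine ⟨v, ?_⟩
    simp [flip, hM, code]
  | drop k S =>
    refine ⟨v, ?_⟩
    simp [flip, hM, code]
  | @seq c d S S' S'' t t' _ _ ih1 ih2 =>
    obtain ⟨v1, h1⟩ := ih1 (emb := emb ∘ Sum.inl) (fun l => hM (Sum.inl l)) v
    obtain ⟨v2, h2⟩ := ih2 (emb := emb ∘ Sum.inr) (fun l => hM (Sum.inr l)) v1
    refine ⟨v2, ?_⟩
    rw [Nat.add_comm, Function.iterate_add_apply]
    exact (congrArg _ h1).trans h2
  | @choose k f S S' t _ ih =>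
    obtain ⟨v1, h1⟩ := ih (emb := fun l => emb (some ⟨_, l⟩)) (fun l => hM (some ⟨_, l⟩))
      (Function.update v k (S k).head?)
    refine ⟨v1, ?_⟩
    rw [Function.iterate_succ_apply, ← h1]
    congr 1
    rw [flip_bind_step, Turing.TM2.step, hM]
    simp only [entry, code, Turing.TM2.stepAux]
    rw [Function.update_self]
  | @loop_false k p c S hp =>
    refine ⟨Function.update v k (S k).head?, ?_⟩
    rw [Function.iterate_one, flip_bind_step, Turing.TM2.step, hM]
    simp [entry, code, hp]
  | @loop_true k p c S S' S'' t t' hp _ _ ih1 ih2 =>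
    obtain ⟨v1, h1⟩ := ih1 (emb := emb ∘ some) (fun l => hM (some l))
      (Function.update v k (S k).head?)
    obtain ⟨v2, h2⟩ := ih2 hM v1
    refine ⟨v2, ?_⟩
    rw [Function.iterate_succ_apply, Nat.add_comm t t', Function.iterate_add_apply, ← h2]
    congr 1
    refine Eq.trans ?_ h1
    congr 1
    rw [flip_bind_step, Turing.TM2.step, hM]
    simp [entry, code, hp]
    rfl

/-- The machine of a program `c`, with input stack `k₀` and output stack `k₁`: run `c`, then reset
the internal state and halt. -/
noncomputable def toMachine [Fintype K] [∀ k, Fintype (Γ k)] (k₀ k₁ : K) (c : Cmd Γ) :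
    Turing.FinTM2 where
  K := K
  k₀ := k₀
  k₁ := k₁
  Γ := Γ
  Λ := Option c.Label
  main := some c.entry
  ΛFin := Fintype.ofFinite _
  σ := ∀ k, Option (Γ k)
  initialState := fun _ => none
  m
    | none => .load (fun _ _ => none) .halt
    | some l => c.code some none l

theorem Exec.evalsTo [Fintype K] [∀ k, Fintype (Γ k)] {k₀ k₁ : K} {c : Cmd Γ}
    {S S' : ∀ k, List (Γ k)} {t : ℕ} (h : Exec c S S' t) :
    (flip bind (c.toMachine k₀ k₁).step)^[t + 1]
      (some (⟨some (some c.entry), fun _ => none, S⟩ : (c.toMachine k₀ k₁).Cfg)) =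
      some ⟨none, fun _ => none, S'⟩ := by
  obtain ⟨v, hv⟩ := h.steps (M := (c.toMachine k₀ k₁).m) (emb := some) (next := none)
    (fun _ => rfl) (fun _ => none)
  rw [Function.iterate_succ_apply']
  refine (congrArg _ hv).trans ?_
  rfl

/-- `Runs c S S' T`: started with stacks `S`, the program `c` ends with stacks `S'` after at most
`T` steps. -/
def Runs (c : Cmd Γ) (S S' : ∀ k, List (Γ k)) (T : ℕ) : Prop := ∃ t ≤ T, Exec c S S' t

theorem Runs.mono {c : Cmd Γ} {S S' : ∀ k, List (Γ k)} {T T' : ℕ} (h : Runs c S S' T)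
    (hT : T ≤ T') : Runs c S S' T' := by
  obtain ⟨t, ht, h⟩ := h
  exact ⟨t, ht.trans hT, h⟩

theorem runs_push (k : K) (x : Γ k) (S : ∀ k, List (Γ k)) :
    Runs (push k x) S (Function.update S k (x :: S k)) 1 := ⟨1, le_rfl, .push k x S⟩

theorem runs_drop (k : K) (S : ∀ k, List (Γ k)) :
    Runs (drop k) S (Function.update S k (S k).tail) 1 := ⟨1, le_rfl, .drop k S⟩

theorem Runs.seq {c d : Cmd Γ} {S S' S'' : ∀ k, List (Γ k)} {T T' : ℕ} (h : Runs c S S' T)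
    (h' : Runs d S' S'' T') : Runs (seq c d) S S'' (T + T') := by
  obtain ⟨t, ht, h⟩ := h
  obtain ⟨t', ht', h'⟩ := h'
  exact ⟨t + t', add_le_add ht ht', h.seq h'⟩

theorem Runs.choose {k : K} {f : Option (Γ k) → Cmd Γ} {S S' : ∀ k, List (Γ k)} {T : ℕ}
    (h : Runs (f (S k).head?) S S' T) : Runs (choose k f) S S' (T + 1) := by
  obtain ⟨t, ht, h⟩ := h
  exact ⟨t + 1, by omega, .choose h⟩

theorem runs_loop_false {k : K} {p : Option (Γ k) → Bool} {c : Cmd Γ} {S : ∀ k, List (Γ k)}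
    (hp : p (S k).head? = false) : Runs (loop k p c) S S 1 := ⟨1, le_rfl, .loop_false hp⟩

theorem Runs.loop_true {k : K} {p : Option (Γ k) → Bool} {c : Cmd Γ} {S S' S'' : ∀ k, List (Γ k)}
    {T T' : ℕ} (hp : p (S k).head? = true) (h : Runs c S S' T) (h' : Runs (loop k p c) S' S'' T') :
    Runs (loop k p c) S S'' (T + T' + 1) := by
  obtain ⟨t, ht, h⟩ := h
  obtain ⟨t', ht', h'⟩ := h'
  exact ⟨t + t' + 1, by omega, .loop_true hp h h'⟩

end Cmd

/-! ### Stacks and their contents -/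

/-- The loop counters: `none` ranges over bit positions, `some i` over row and column indices. -/
abbrev Ptr : Type := Option (Fin 4)

/-- The stacks of the machines: the input and a stack for the part of it already passed, two stacks
for each counter, which hold its value and its distance to its bound in unary, a stack that keeps a
copy of a counter while it is counted down, a stack of intermediate values and the output. -/
inductive StackName : Type
  | inp | aux | ptr (p : Ptr) | rem (p : Ptr) | cnt | val | out
  deriving DecidableEq, Fintype

/-- The intermediate values of a computation: integers, clipped to the range from `-3` to `3`, as a
stack alphabet has to be finite. The bound `3` is large enough to tell the entries `0`, `1`, `2`
from each other and from all larger ones. -/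
abbrev Val : Type := Set.Icc (-3 : ℤ) 3

/-- The value in the range from `-3` to `3` that is closest to `x`. -/
noncomputable def clip (x : ℤ) : Val := ⟨max (-3) (min 3 x), by rw [Set.mem_Icc]; omega⟩

theorem coe_clip (x : ℤ) : (clip x : ℤ) = max (-3) (min 3 x) := rfl

/-- The stack alphabets, for the output alphabet `O`. -/
@[reducible]
def Alphabet (O : Type) : StackName → Type
  | .inp => Symbol
  | .aux => Symbol
  | .ptr _ => Unit
  | .rem _ => Unit
  | .cnt => Unit
  | .val => Val
  | .out => O

noncomputable instance {O : Type} [Fintype O] (k : StackName) : Fintype (Alphabet O k) := by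
  cases k <;> infer_instance

/-- The contents of all stacks; a unary stack is given by its height. -/
structure Mem (O : Type) where
  inp : List Symbol
  aux : List Symbol
  ptr : Ptr → ℕ
  rem : Ptr → ℕ
  cnt : ℕ
  val : List Val
  out : List O

/-- The actual stacks. -/
def Mem.stacks {O : Type} (m : Mem O) : ∀ k, List (Alphabet O k)
  | .inp => m.inp
  | .aux => m.aux
  | .ptr p => List.replicate (m.ptr p) ()
  | .rem p => List.replicate (m.rem p) ()
  | .cnt => List.replicate m.cnt ()
  | .val => m.val
  | .out => m.out

section Update

variable {O : Type} (m : Mem O)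

theorem update_inp (l : List Symbol) :
    Function.update m.stacks .inp l = { m with inp := l }.stacks := by
  funext k; cases k <;> simp [Mem.stacks]

theorem update_aux (l : List Symbol) :
    Function.update m.stacks .aux l = { m with aux := l }.stacks := by
  funext k; cases k <;> simp [Mem.stacks]

theorem update_ptr (p : Ptr) (x : ℕ) :
    Function.update m.stacks (.ptr p) (List.replicate x ()) =
      { m with ptr := Function.update m.ptr p x }.stacks := by
  funext k
  rcases k with - | - | q | q | - | - | - <;> try simp [Mem.stacks]
  by_cases h : q = p
  · subst h; simp
  · rw [Function.update_of_ne (by simpa using h)]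
    simp [Mem.stacks, Function.update_of_ne h]

theorem update_rem (p : Ptr) (x : ℕ) :
    Function.update m.stacks (.rem p) (List.replicate x ()) =
      { m with rem := Function.update m.rem p x }.stacks := by
  funext k
  rcases k with - | - | q | q | - | - | - <;> try simp [Mem.stacks]
  by_cases h : q = p
  · subst h; simp
  · rw [Function.update_of_ne (by simpa using h)]
    simp [Mem.stacks, Function.update_of_ne h]

theorem update_cnt (x : ℕ) :
    Function.update m.stacks .cnt (List.replicate x ()) = { m with cnt := x }.stacks := by
  funext k; cases k <;> simp [Mem.stacks]

theorem update_val (l : List Val) :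
    Function.update m.stacks .val l = { m with val := l }.stacks := by
  funext k; cases k <;> simp [Mem.stacks]

theorem update_out (l : List O) :
    Function.update m.stacks .out l = { m with out := l }.stacks := by
  funext k; cases k <;> simp [Mem.stacks]

end Update

/-- `Does c m m' T`: the program `c` turns the contents `m` into `m'` within `T` steps. -/
def Does {O : Type} (c : Cmd (Alphabet O)) (m m' : Mem O) (T : ℕ) : Prop :=
  c.Runs m.stacks m'.stacks T

section Basic

variable {O : Type}

theorem Does.mono {c : Cmd (Alphabet O)} {m m' : Mem O} {T T' : ℕ} (h : Does c m m' T)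
    (hT : T ≤ T') : Does c m m' T' := Cmd.Runs.mono h hT

theorem Does.seq {c d : Cmd (Alphabet O)} {m m' m'' : Mem O} {T T' : ℕ} (h : Does c m m' T)
    (h' : Does d m' m'' T') : Does (.seq c d) m m'' (T + T') := Cmd.Runs.seq h h'

theorem Does.choose {k : StackName} {f : Option (Alphabet O k) → Cmd (Alphabet O)} {m m' : Mem O}
    {T : ℕ} (h : Does (f (m.stacks k).head?) m m' T) : Does (.choose k f) m m' (T + 1) :=
  Cmd.Runs.choose h

theorem does_loop_false {k : StackName} {p : Option (Alphabet O k) → Bool}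
    {c : Cmd (Alphabet O)} {m : Mem O} (hp : p (m.stacks k).head? = false) :
    Does (.loop k p c) m m 1 := Cmd.runs_loop_false hp

theorem Does.loop_true {k : StackName} {p : Option (Alphabet O k) → Bool} {c : Cmd (Alphabet O)}
    {m m' m'' : Mem O} {T T' : ℕ} (h : Does c m m' T) (h' : Does (.loop k p c) m' m'' T')
    (hp : p (m.stacks k).head? = true) : Does (.loop k p c) m m'' (T + T' + 1) :=
  Cmd.Runs.loop_true hp h h'

variable (m : Mem O)

theorem does_push_inp (s : Symbol) :
    Does (.push .inp s) m { m with inp := s :: m.inp } 1 := by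
  have := Cmd.runs_push .inp s m.stacks
  rwa [show s :: m.stacks .inp = s :: m.inp from rfl, update_inp] at this

theorem does_push_aux (s : Symbol) :
    Does (.push .aux s) m { m with aux := s :: m.aux } 1 := by
  have := Cmd.runs_push .aux s m.stacks
  rwa [show s :: m.stacks .aux = s :: m.aux from rfl, update_aux] at this

theorem does_push_ptr (p : Ptr) :
    Does (.push (.ptr p) ()) m { m with ptr := Function.update m.ptr p (m.ptr p + 1) } 1 := by
  have := Cmd.runs_push (.ptr p) () m.stacks
  rwa [show () :: m.stacks (.ptr p) = List.replicate (m.ptr p + 1) () from rfl, update_ptr] at this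

theorem does_push_rem (p : Ptr) :
    Does (.push (.rem p) ()) m { m with rem := Function.update m.rem p (m.rem p + 1) } 1 := by
  have := Cmd.runs_push (.rem p) () m.stacks
  rwa [show () :: m.stacks (.rem p) = List.replicate (m.rem p + 1) () from rfl, update_rem] at this

theorem does_push_cnt : Does (.push .cnt ()) m { m with cnt := m.cnt + 1 } 1 := by
  have := Cmd.runs_push .cnt () m.stacks
  rwa [show () :: m.stacks .cnt = List.replicate (m.cnt + 1) () from rfl, update_cnt] at this

theorem does_push_val (v : Val) : Does (.push .val v) m { m with val := v :: m.val } 1 := by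
  have := Cmd.runs_push .val v m.stacks
  rwa [show v :: m.stacks .val = v :: m.val from rfl, update_val] at this

theorem does_push_out (o : O) : Does (.push .out o) m { m with out := o :: m.out } 1 := by
  have := Cmd.runs_push (Γ := Alphabet O) .out o m.stacks
  rwa [show o :: m.stacks .out = o :: m.out from rfl, update_out] at this

theorem does_drop_inp : Does (.drop .inp) m { m with inp := m.inp.tail } 1 := by
  have := Cmd.runs_drop .inp m.stacks
  rwa [show (m.stacks .inp).tail = m.inp.tail from rfl, update_inp] at this

theorem does_drop_aux : Does (.drop .aux) m { m with aux := m.aux.tail } 1 := by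
  have := Cmd.runs_drop .aux m.stacks
  rwa [show (m.stacks .aux).tail = m.aux.tail from rfl, update_aux] at this

theorem does_drop_ptr (p : Ptr) :
    Does (.drop (.ptr p)) m { m with ptr := Function.update m.ptr p (m.ptr p - 1) } 1 := by
  have := Cmd.runs_drop (.ptr p) m.stacks
  rwa [show (m.stacks (.ptr p)).tail = List.replicate (m.ptr p - 1) () by
    simp [Mem.stacks], update_ptr] at this

theorem does_drop_rem (p : Ptr) :
    Does (.drop (.rem p)) m { m with rem := Function.update m.rem p (m.rem p - 1) } 1 := by
  have := Cmd.runs_drop (.rem p) m.stacks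
  rwa [show (m.stacks (.rem p)).tail = List.replicate (m.rem p - 1) () by
    simp [Mem.stacks], update_rem] at this

theorem does_drop_cnt : Does (.drop .cnt) m { m with cnt := m.cnt - 1 } 1 := by
  have := Cmd.runs_drop .cnt m.stacks
  rwa [show (m.stacks .cnt).tail = List.replicate (m.cnt - 1) () by
    simp [Mem.stacks], update_cnt] at this

theorem does_drop_val : Does (.drop .val) m { m with val := m.val.tail } 1 := by
  have := Cmd.runs_drop .val m.stacks
  rwa [show (m.stacks .val).tail = m.val.tail from rfl, update_val] at this

end Basic

/-! ### Moving through the input -/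

section Programs

variable {O : Type}

theorem Does.to {c : Cmd (Alphabet O)} {m m' m'' : Mem O} {T T' : ℕ} (h : Does c m m' T)
    (hm : m' = m'') (hT : T ≤ T') : Does c m m'' T' := hm ▸ h.mono hT

/-- Repeat a program until the stack `k` is empty. -/
def untilEmpty (k : StackName) (c : Cmd (Alphabet O)) : Cmd (Alphabet O) :=
  .loop k Option.isSome c

theorem does_untilEmpty_nil {k : StackName} {c : Cmd (Alphabet O)} {m m' : Mem O}
    (hk : m.stacks k = []) (hm : m = m') : Does (untilEmpty k c) m m' 1 :=
  hm ▸ does_loop_false (by simp [hk])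

theorem Does.untilEmpty_cons {k : StackName} {c : Cmd (Alphabet O)} {m m' m'' : Mem O} {T T' : ℕ}
    (h : Does c m m' T) (h' : Does (untilEmpty k c) m' m'' T') (hk : m.stacks k ≠ []) :
    Does (untilEmpty k c) m m'' (T + T' + 1) := by
  refine h.loop_true h' ?_
  rcases hS : m.stacks k with - | ⟨a, l⟩
  · exact absurd hS hk
  · rfl

/-- Move the auxiliary count to the counter `p`. -/
def restore (p : Ptr) : Cmd (Alphabet O) :=
  untilEmpty .cnt (.seq (.drop .cnt) (.push (.ptr p) ()))

theorem does_restore (p : Ptr) (x : ℕ) (m : Mem O) (hx : m.cnt = x) :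
    Does (restore p) m { m with cnt := 0, ptr := Function.update m.ptr p (m.ptr p + x) }
      (3 * x + 1) := by
  induction x generalizing m with
  | zero =>
    refine does_untilEmpty_nil ?_ ?_
    · simp [Mem.stacks, hx]
    · cases m; simp_all
  | succ x ih =>
    refine (((does_drop_cnt m).seq (does_push_ptr _ p)).untilEmpty_cons (ih _ ?_) ?_).to ?_ ?_
    · simp [hx]
    · simp [Mem.stacks, hx, List.replicate_succ]
    · simp [add_assoc, add_comm 1]
    · omega

/-- Reset the counter `p` to its bound. -/
def refill (p : Ptr) : Cmd (Alphabet O) :=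
  untilEmpty (.rem p) (.seq (.drop (.rem p)) (.push (.ptr p) ()))

theorem does_refill (p : Ptr) (x : ℕ) (m : Mem O) (hx : m.rem p = x) :
    Does (refill p) m
      { m with rem := Function.update m.rem p 0, ptr := Function.update m.ptr p (m.ptr p + x) }
      (3 * x + 1) := by
  induction x generalizing m with
  | zero =>
    refine does_untilEmpty_nil ?_ ?_
    · simp [Mem.stacks, hx]
    · cases m; simp_all
  | succ x ih =>
    refine (((does_drop_rem m p).seq (does_push_ptr _ p)).untilEmpty_cons (ih _ ?_) ?_).to ?_ ?_
    · simp [hx]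
    · simp [Mem.stacks, hx, List.replicate_succ]
    · simp [add_assoc, add_comm 1]
    · omega

/-- Move one symbol of the input to the part already passed. -/
def forward : Cmd (Alphabet O) :=
  .choose .inp fun o => o.elim (.drop .inp) fun s => .seq (.drop .inp) (.push .aux s)

theorem does_forward {m : Mem O} {s : Symbol} {w : List Symbol} (h : m.inp = s :: w) :
    Does forward m { m with inp := w, aux := s :: m.aux } 3 := by
  refine Does.choose (T := 2) ?_
  have := (does_drop_inp m).seq (does_push_aux _ s)
  simpa [Mem.stacks, h] using this

/-- Return to the start of the input. -/
def rewind : Cmd (Alphabet O) :=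
  untilEmpty .aux
    (.choose .aux fun o => o.elim (.drop .aux) fun s => .seq (.drop .aux) (.push .inp s))

theorem does_rewind (u : List Symbol) (m : Mem O) (hu : m.aux = u) :
    Does rewind m { m with inp := u.reverse ++ m.inp, aux := [] } (4 * u.length + 1) := by
  induction u generalizing m with
  | nil =>
    refine does_untilEmpty_nil ?_ ?_
    · simp [Mem.stacks, hu]
    · cases m; simp_all
  | cons s u ih =>
    have h1 : Does (.choose .aux fun o => o.elim (.drop .aux) fun s =>
        .seq (.drop .aux) (.push .inp s)) m { m with inp := s :: m.inp, aux := u } 3 := by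
      refine Does.choose (T := 2) ?_
      have := (does_drop_aux m).seq (does_push_inp _ s)
      simpa [Mem.stacks, hu] using this
    refine (h1.untilEmpty_cons (ih _ rfl) ?_).to ?_ ?_
    · simp [Mem.stacks, hu]
    · simp
    · simp only [List.length_cons]
      omega

/-- Pass the input up to and including the next occurrence of `s`. -/
def skipPast (s : Symbol) : Cmd (Alphabet O) :=
  .seq (.loop .inp (fun o => o.isSome && decide (o ≠ some s)) forward) forward

theorem does_skipPast {s : Symbol} (u w : List Symbol) (hs : s ∉ u) (m : Mem O)
    (hm : m.inp = u ++ s :: w) :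
    Does (skipPast s) m { m with inp := w, aux := s :: (u.reverse ++ m.aux) }
      (4 * u.length + 4) := by
  suffices H : Does (.loop .inp (fun o => o.isSome && decide (o ≠ some s)) forward) m
      { m with inp := s :: w, aux := u.reverse ++ m.aux } (4 * u.length + 1) from
    H.seq (does_forward rfl)
  induction u generalizing m with
  | nil =>
    simp only [List.nil_append] at hm
    refine (does_loop_false (m := m) ?_).to ?_ (by simp)
    · simp [Mem.stacks, hm]
    · simp [← hm]
  | cons a u ih =>
    rw [List.mem_cons, not_or] at hs
    refine ((does_forward hm).loop_true (ih hs.2 _ rfl) ?_).to ?_ ?_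
    · simp [Mem.stacks, hm, Ne.symm hs.1]
    · simp
    · simp only [List.length_cons]
      omega

/-- Pass as many blocks of the input that end with `s` as the counter `p` says. -/
def seek (p : Ptr) (s : Symbol) : Cmd (Alphabet O) :=
  .seq (untilEmpty (.ptr p) (.seq (.drop (.ptr p)) (.seq (.push .cnt ()) (skipPast s)))) (restore p)

theorem does_seek {p : Ptr} {s : Symbol} (bs : List (List Symbol)) (w : List Symbol)
    (hs : ∀ u ∈ bs, s ∉ u) (m : Mem O) (hm : m.inp = bs.flatMap (· ++ [s]) ++ w)
    (hp : m.ptr p = bs.length) (hc : m.cnt = 0) :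
    Does (seek p s) m { m with inp := w, aux := (bs.flatMap (· ++ [s])).reverse ++ m.aux }
      (10 * (bs.flatMap (· ++ [s])).length + 2) := by
  have hlen : ∀ bs : List (List Symbol), bs.length ≤ (bs.flatMap (· ++ [s])).length := by
    intro bs
    induction bs with
    | nil => simp
    | cons u bs ih => simp only [List.flatMap_cons, List.length_append, List.length_cons]; omega
  suffices H : Does
      (untilEmpty (.ptr p) (.seq (.drop (.ptr p)) (.seq (.push .cnt ()) (skipPast s)))) m
      { m with
        inp := w, aux := (bs.flatMap (· ++ [s])).reverse ++ m.aux,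
        ptr := Function.update m.ptr p 0, cnt := m.cnt + bs.length }
      (7 * (bs.flatMap (· ++ [s])).length + 1) by
    refine (H.seq (does_restore p bs.length _ ?_)).to ?_ ?_
    · simp [hc]
    · simp [← hp, ← hc]
    · have := hlen bs
      omega
  clear hc
  induction bs generalizing m with
  | nil =>
    simp only [List.flatMap_nil, List.nil_append] at hm
    simp only [List.length_nil] at hp
    refine does_untilEmpty_nil ?_ ?_
    · simp [Mem.stacks, hp]
    · cases m; simp_all
  | cons u bs ih =>
    refine (((does_drop_ptr m p).seq ((does_push_cnt _).seq
      (does_skipPast u (bs.flatMap (· ++ [s]) ++ w) (hs u (by simp)) _ ?_))).untilEmpty_cons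
      (ih (fun v hv => hs v (by simp [hv])) _ rfl ?_) ?_).to ?_ ?_
    · simp [hm]
    · simp [hp]
    · simp [Mem.stacks, hp, List.replicate_succ]
    · simp [add_assoc, add_comm 1]
    · simp only [List.flatMap_cons, List.length_append, List.length_cons, List.length_nil]
      omega

/-- Pass one bit of the current entry, if there is one left, and count the attempt. -/
def passBit : Cmd (Alphabet O) :=
  .choose .inp fun
    | some (.bit b) => .seq (.drop .inp) (.seq (.push .aux (.bit b)) (.push .cnt ()))
    | _ => .push .cnt ()

theorem does_passBit (l : List Bool) (w : List Symbol) (m : Mem O)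
    (hm : m.inp = l.map Symbol.bit ++ .comma :: w) :
    Does passBit m
      { m with
        inp := (l.drop 1).map Symbol.bit ++ .comma :: w,
        aux := ((l.take 1).map Symbol.bit).reverse ++ m.aux, cnt := m.cnt + 1 } 4 := by
  refine Does.choose (T := 3) ?_
  rcases l with - | ⟨b, l⟩
  · simp only [List.map_nil, List.nil_append] at hm
    have : (m.stacks .inp).head? = some Symbol.comma := by simp [Mem.stacks, hm]
    rw [this]
    exact (does_push_cnt m).to (by simp [← hm]) (by omega)
  · have : (m.stacks .inp).head? = some (Symbol.bit b) := by simp [Mem.stacks, hm]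
    rw [this]
    exact ((does_drop_inp m).seq ((does_push_aux _ (.bit b)).seq (does_push_cnt _))).to
      (by simp [hm]) (by omega)

/-- Pass as many bits of the current entry as the counter `none` says, or all of them. -/
def seekBit : Cmd (Alphabet O) :=
  .seq (untilEmpty (.ptr none) (.seq (.drop (.ptr none)) passBit)) (restore none)

theorem does_seekBit (t : ℕ) (l : List Bool) (w : List Symbol) (m : Mem O)
    (hm : m.inp = l.map Symbol.bit ++ .comma :: w) (ht : m.ptr none = t) (hc : m.cnt = 0) :
    Does seekBit m
      { m with
        inp := (l.drop t).map Symbol.bit ++ .comma :: w,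
        aux := ((l.take t).map Symbol.bit).reverse ++ m.aux } (9 * t + 2) := by
  suffices H : Does (untilEmpty (.ptr none) (.seq (.drop (.ptr none)) passBit)) m
      { m with
        inp := (l.drop t).map Symbol.bit ++ .comma :: w,
        aux := ((l.take t).map Symbol.bit).reverse ++ m.aux,
        ptr := Function.update m.ptr none 0, cnt := m.cnt + t }
      (6 * t + 1) by
    refine (H.seq (does_restore none t _ ?_)).to ?_ ?_
    · simp [hc]
    · simp [← ht, ← hc]
    · omega
  clear hc
  induction t generalizing m l with
  | zero =>
    refine does_untilEmpty_nil ?_ ?_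
    · simp [Mem.stacks, ht]
    · cases m; simp_all
  | succ t ih =>
    refine (((does_drop_ptr m none).seq (does_passBit l w _ hm)).untilEmpty_cons
      (ih _ _ rfl ?_) ?_).to ?_ ?_
    · simp [ht]
    · simp [Mem.stacks, ht, List.replicate_succ]
    · rcases l with - | ⟨b, l⟩ <;> simp [add_assoc, add_comm 1]
    · omega

/-- Push the bit at the current position of the input, or `0` if there is a comma. -/
noncomputable def pushBit : Cmd (Alphabet O) :=
  .choose .inp fun
    | some (.bit true) => .push .val (clip 1)
    | _ => .push .val (clip 0)

theorem does_pushBit (l : List Bool) (w : List Symbol) (m : Mem O)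
    (hm : m.inp = l.map Symbol.bit ++ .comma :: w) :
    Does pushBit m { m with val := clip (if l.head? = some true then 1 else 0) :: m.val } 2 := by
  refine Does.choose (T := 1) ?_
  rcases l with - | ⟨- | -, l⟩
  · have : (m.stacks .inp).head? = some Symbol.comma := by simp [Mem.stacks, hm]
    rw [this]
    exact does_push_val m _
  · have : (m.stacks .inp).head? = some (Symbol.bit false) := by simp [Mem.stacks, hm]
    rw [this]
    exact does_push_val m _
  · have : (m.stacks .inp).head? = some (Symbol.bit true) := by simp [Mem.stacks, hm]
    rw [this]
    exact does_push_val m _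

/-- Replace the two topmost values `y` and `x` by the clipped value of `f x y`. -/
noncomputable def applyOp (f : ℤ → ℤ → ℤ) : Cmd (Alphabet O) :=
  .choose .val fun y => .seq (.drop .val) (.choose .val fun x => .seq (.drop .val)
    (.push .val (clip (f (x.getD (clip 0) : Val) (y.getD (clip 0) : Val)))))

theorem does_applyOp (f : ℤ → ℤ → ℤ) {m : Mem O} {x y : Val} {vs : List Val}
    (hm : m.val = y :: x :: vs) :
    Does (applyOp f) m { m with val := clip (f x y) :: vs } 5 := by
  refine Does.choose (T := 4) ((does_drop_val m).seq (Does.choose (T := 2) ?_))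
  have := (does_drop_val { m with val := m.val.tail }).seq (does_push_val _ (clip (f x y)))
  simpa [Mem.stacks, hm] using this

/-- Empty the stack `k`. -/
def clear (k : StackName) : Cmd (Alphabet O) := untilEmpty k (.drop k)

theorem does_clear_inp (l : List Symbol) (m : Mem O) (hm : m.inp = l) :
    Does (clear .inp) m { m with inp := [] } (2 * l.length + 1) := by
  induction l generalizing m with
  | nil =>
    refine does_untilEmpty_nil ?_ ?_
    · simp [Mem.stacks, hm]
    · simp [← hm]
  | cons s l ih =>
    refine ((does_drop_inp m).untilEmpty_cons (ih _ ?_) ?_).to rfl ?_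
    · simp [hm]
    · simp [Mem.stacks, hm]
    · simp only [List.length_cons]
      omega

theorem does_clear_ptr (p : Ptr) (x : ℕ) (m : Mem O) (hm : m.ptr p = x) :
    Does (clear (.ptr p)) m { m with ptr := Function.update m.ptr p 0 } (2 * x + 1) := by
  induction x generalizing m with
  | zero =>
    refine does_untilEmpty_nil ?_ ?_
    · simp [Mem.stacks, hm]
    · simp [← hm]
  | succ x ih =>
    refine ((does_drop_ptr m p).untilEmpty_cons (ih _ ?_) ?_).to ?_ ?_
    · simp [hm]
    · simp [Mem.stacks, hm, List.replicate_succ]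
    · simp
    · omega

end Programs

/-! ### The encoding of an instance -/

/-- The entries of an instance, with the value `0` outside its range. -/
def Instance.entry (I : Instance) (i j : ℕ) : ℕ :=
  if h : i < I.1 ∧ j < I.1 then I.2 ⟨i, h.1⟩ ⟨j, h.2⟩ else 0

/-- The length of the input. -/
def Instance.size (I : Instance) : ℕ := (encodeInstance I).length

theorem encodePosNum_getElem? (m : PosNum) (t : ℕ) :
    (encodePosNum m)[t]? = some true ↔ m.testBit t = true := by
  induction m generalizing t with
  | one => cases t <;> simp [encodePosNum, PosNum.testBit]
  | bit0 m ih => cases t <;> simp [encodePosNum, PosNum.testBit, ih]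
  | bit1 m ih => cases t <;> simp [encodePosNum, PosNum.testBit, ih]

/-- The encoding of a number lists its bits, the least significant one first. -/
theorem encodeNat_getElem? (m t : ℕ) : (encodeNat m)[t]? = some true ↔ m.testBit t = true := by
  have h : ((m : Num) : ℕ).testBit t = (m : Num).testBit t := (Num.castNum_testBit _ _).symm
  rw [Num.to_of_nat] at h
  rw [h, encodeNat]
  rcases (m : Num) with - | p
  · simp [encodeNum, Num.testBit]
  · simp [encodeNum, Num.testBit, encodePosNum_getElem?]

/-- The encoding of the row `i` of an instance, without its semicolon. -/
def encodeRow (I : Instance) (i : Fin I.1) : List Symbol :=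
  (List.finRange I.1).flatMap fun j => (encodeNat (I.2 i j)).map Symbol.bit ++ [.comma]

theorem encodeInstance_eq (I : Instance) :
    encodeInstance I = ((List.finRange I.1).map (encodeRow I)).flatMap (· ++ [.semicolon]) := by
  simp [encodeInstance, encodeRow, List.flatMap_map]

theorem semicolon_notMem_encodeRow (I : Instance) (i : Fin I.1) :
    Symbol.semicolon ∉ encodeRow I i := by
  simp [encodeRow]

theorem flatMap_eq_of_getElem {α β : Type} (l : List α) (f : α → List β) (i : ℕ)
    (hi : i < l.length) :
    l.flatMap f = (l.take i).flatMap f ++ (f l[i] ++ (l.drop (i + 1)).flatMap f) := by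
  rw [← List.flatMap_cons, ← List.drop_eq_getElem_cons hi, ← List.flatMap_append,
    List.take_append_drop]

/-- The position of the entry `(i, j)` in the input. -/
theorem encodeInstance_split (I : Instance) {i j : ℕ} (hi : i < I.1) (hj : j < I.1) :
    ∃ (rows cells : List (List Symbol)) (w : List Symbol),
      (∀ u ∈ rows, Symbol.semicolon ∉ u) ∧ (∀ u ∈ cells, Symbol.comma ∉ u) ∧
      rows.length = i ∧ cells.length = j ∧
      encodeInstance I = rows.flatMap (· ++ [.semicolon]) ++ (cells.flatMap (· ++ [.comma]) ++
        ((encodeNat (I.entry i j)).map Symbol.bit ++ .comma :: w)) := by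
  refine ⟨((List.finRange I.1).map (encodeRow I)).take i,
    ((List.finRange I.1).map fun j =>
      (encodeNat (I.2 ⟨i, hi⟩ j)).map Symbol.bit).take j,
    ((List.finRange I.1).drop (j + 1)).flatMap
      (fun j => (encodeNat (I.2 ⟨i, hi⟩ j)).map Symbol.bit ++ [.comma]) ++ .semicolon ::
    (((List.finRange I.1).map (encodeRow I)).drop (i + 1)).flatMap (· ++ [.semicolon]),
    ?_, ?_, ?_, ?_, ?_⟩
  · intro u hu
    obtain ⟨k, -, rfl⟩ := List.mem_map.1 (List.mem_of_mem_take hu)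
    exact semicolon_notMem_encodeRow I k
  · intro u hu
    obtain ⟨k, -, rfl⟩ := List.mem_map.1 (List.mem_of_mem_take hu)
    simp
  · simp [hi.le]
  · simp [hj.le]
  · rw [encodeInstance_eq, flatMap_eq_of_getElem _ _ i (by simpa using hi)]
    congr 1
    rw [List.getElem_map, List.getElem_finRange, encodeRow,
      flatMap_eq_of_getElem _ _ j (by simpa using hj), List.getElem_finRange, Instance.entry,
      dif_pos ⟨hi, hj⟩, ← List.map_take, List.flatMap_map]
    simp

theorem count_semicolon_encodeInstance (I : Instance) :
    (encodeInstance I).count .semicolon = I.1 := by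
  rw [encodeInstance_eq, List.count_flatMap, List.map_map]
  have : (List.count Symbol.semicolon ∘ fun x => x ++ [Symbol.semicolon]) ∘ encodeRow I =
      fun _ => 1 := by
    funext i
    simp [List.count_eq_zero.2 (semicolon_notMem_encodeRow I i)]
  rw [this]
  simp

theorem le_size (I : Instance) : I.1 ≤ I.size := by
  conv_lhs => rw [← count_semicolon_encodeInstance I]
  exact List.count_le_length

theorem length_encodeNat_le_size (I : Instance) {i j : ℕ} (hi : i < I.1) (hj : j < I.1) :
    (encodeNat (I.entry i j)).length ≤ I.size := by
  obtain ⟨rows, cells, w, -, -, -, -, h⟩ := encodeInstance_split I hi hj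
  rw [Instance.size, h]
  simp only [List.length_append, List.length_map]
  omega

theorem entry_lt_two_pow (I : Instance) (i j : ℕ) : I.entry i j < 2 ^ I.size := by
  by_cases h : i < I.1 ∧ j < I.1
  · apply Nat.lt_pow_two_of_testBit
    intro t ht
    rw [← Bool.not_eq_true, ← encodeNat_getElem?, List.getElem?_eq_none
      ((length_encodeNat_le_size I h.1 h.2).trans ht)]
    simp
  · rw [Instance.entry, dif_neg h]
    positivity

/-! ### A language of expressions about an instance -/

/-- The bound of a counter. -/
def Instance.bound (I : Instance) : Ptr → ℕ
  | none => I.size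
  | some _ => I.1

/-- Expressions about an instance. -/
inductive Expr : Type
  /-- the bit number `none` of the entry at the row `i` and the column `j` -/
  | bit (i j : Fin 4)
  /-- apply a function to two values, and clip the result -/
  | op (f : ℤ → ℤ → ℤ) (a b : Expr)
  /-- start with the value `z`; let `p` run downwards through all numbers below its bound, and for
  each of them replace the value by the clipped image, under `f`, of it and the value of `b` -/
  | fold (p : Ptr) (z : ℤ) (f : ℤ → ℤ → ℤ) (b : Expr)

/-- The value of an expression at a setting of the counters. -/
noncomputable def Expr.eval (I : Instance) : Expr → (Ptr → ℕ) → Val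
  | bit i j, env =>
    clip (if (I.entry (env (some i)) (env (some j))).testBit (env none) then 1 else 0)
  | op f a b, env => clip (f (a.eval I env) (b.eval I env))
  | fold p z f b, env => (List.range (I.bound p)).foldr
      (fun x v => clip (f v (b.eval I (Function.update env p x)))) (clip z)

/-- All row and column indices that an expression reads are among those in `s` or are set by an
enclosing loop, and no loop sets a counter that is in use. -/
def Expr.Scoped : Expr → Finset Ptr → Prop
  | bit i j, s => some i ∈ s ∧ some j ∈ s
  | op _ a b, s => a.Scoped s ∧ b.Scoped s
  | fold p _ _ b, s => p ∉ s ∧ b.Scoped (insert p s)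

/-- The counters in `s` are in use, and all others stand at their bounds. -/
def InScope (I : Instance) (s : Finset Ptr) (env : Ptr → ℕ) : Prop :=
  (∀ p ∈ s, env p < I.bound p) ∧ ∀ p ∉ s, env p = I.bound p

theorem InScope.le {I : Instance} {s : Finset Ptr} {env : Ptr → ℕ} (h : InScope I s env)
    (p : Ptr) : env p ≤ I.bound p := by
  by_cases hp : p ∈ s
  · exact (h.1 p hp).le
  · exact (h.2 p hp).le

theorem InScope.insert {I : Instance} {s : Finset Ptr} {env : Ptr → ℕ} (h : InScope I s env)
    {p : Ptr} {x : ℕ} (hx : x < I.bound p) :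
    InScope I (insert p s) (Function.update env p x) := by
  constructor
  · intro q hq
    by_cases hqp : q = p
    · subst hqp
      simpa using hx
    · rw [Function.update_of_ne hqp]
      exact h.1 q ((Finset.mem_insert.1 hq).resolve_left hqp)
  · intro q hq
    rw [Finset.mem_insert, not_or] at hq
    rw [Function.update_of_ne hq.1]
    exact h.2 q hq.2

/-- The contents of the stacks between two steps of a computation with expressions: the input is
read from its start, and the two stacks of a counter add up to its bound. -/
def canon {O : Type} (I : Instance) (env : Ptr → ℕ) (vs : List Val) (out : List O) : Mem O where
  inp := encodeInstance I
  aux := []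
  ptr := env
  rem p := I.bound p - env p
  cnt := 0
  val := vs
  out := out

section Loop

variable {O : Type}

/-- Let `p` run downwards through all numbers below its bound, then reset it. -/
def countdown (p : Ptr) (c : Cmd (Alphabet O)) : Cmd (Alphabet O) :=
  .seq (untilEmpty (.ptr p) (.seq (.drop (.ptr p)) (.seq (.push (.rem p) ()) c))) (refill p)

/-- The rule for loops: if the body turns `F (x + 1)` into `F x` when the counter is `x`, the loop
turns `F` of the bound into `F 0`. -/
theorem does_countdown {I : Instance} {env : Ptr → ℕ} {p : Ptr} {c : Cmd (Alphabet O)} {T : ℕ}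
    {F : ℕ → List Val × List O} (henv : env p = I.bound p)
    (hc : ∀ x < I.bound p, Does c
      (canon I (Function.update env p x) (F (x + 1)).1 (F (x + 1)).2)
      (canon I (Function.update env p x) (F x).1 (F x).2) T) :
    Does (countdown p c) (canon I env (F (I.bound p)).1 (F (I.bound p)).2)
      (canon I env (F 0).1 (F 0).2) (I.bound p * (T + 6) + 2) := by
  have H : ∀ x ≤ I.bound p,
      Does (untilEmpty (.ptr p) (.seq (.drop (.ptr p)) (.seq (.push (.rem p) ()) c)))
        (canon I (Function.update env p x) (F x).1 (F x).2)
        (canon I (Function.update env p 0) (F 0).1 (F 0).2) (x * (T + 3) + 1) := by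
    intro x
    induction x with
    | zero =>
      intro _
      refine (does_untilEmpty_nil ?_ rfl).to rfl (by omega)
      simp [Mem.stacks, canon]
    | succ x ih =>
      intro hx
      refine Does.to (Does.untilEmpty_cons ((does_drop_ptr _ p).seq
        (((does_push_rem _ p).to (m'' := canon I (Function.update env p x) (F (x + 1)).1
          (F (x + 1)).2) ?_ le_rfl).seq (hc x hx))) (ih (by omega)) ?_) rfl ?_
      · simp only [canon, Function.update_self, Function.update_idem, Nat.add_sub_cancel,
          Mem.mk.injEq, and_self, and_true, true_and]
        funext q
        by_cases hq : q = p
        · subst hq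
          simp only [Function.update_self]
          omega
        · simp [Function.update_of_ne hq]
      · simp [Mem.stacks, canon, List.replicate_succ]
      · rw [Nat.succ_mul]
        omega
  have h1 := H _ le_rfl
  rw [← henv, Function.update_eq_self, henv] at h1
  refine (h1.seq (does_refill p (I.bound p) _ ?_)).to ?_ ?_
  · simp [canon]
  · simp only [canon, Function.update_self, Function.update_idem, Nat.zero_add,
      Mem.mk.injEq, and_self, and_true, true_and]
    constructor
    · rw [← henv, Function.update_eq_self]
    · funext q
      by_cases hq : q = p
      · subst hq
        simp [henv]
      · simp [Function.update_of_ne hq]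
  · rw [Nat.mul_add, Nat.mul_add]
    omega

/-- Push the bit number `none` of the entry `(i, j)`. -/
noncomputable def lookup (i j : Fin 4) : Cmd (Alphabet O) :=
  .seq (seek (some i) .semicolon) (.seq (seek (some j) .comma) (.seq seekBit
    (.seq pushBit rewind)))

theorem does_lookup {I : Instance} {env : Ptr → ℕ} {i j : Fin 4} (hi : env (some i) < I.1)
    (hj : env (some j) < I.1) (ht : env none ≤ I.size) (vs : List Val) (out : List O) :
    Does (lookup i j) (canon I env vs out)
      (canon I env ((Expr.bit i j).eval I env :: vs) out) (33 * I.size + 9) := by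
  obtain ⟨rows, cells, w, hrows, hcells, hri, hcj, h⟩ := encodeInstance_split I hi hj
  have hlen := congrArg List.length h
  simp only [List.length_append, List.length_cons, List.length_map] at hlen
  rw [← Instance.size] at hlen
  set l := encodeNat (I.entry (env (some i)) (env (some j))) with hl
  refine (((does_seek rows _ hrows _ ?_ ?_ ?_).seq ((does_seek cells _ hcells _ rfl ?_ ?_).seq
    ((does_seekBit (env none) l w _ rfl ?_ ?_).seq ((does_pushBit (l.drop (env none)) w _ rfl).seq
    (does_rewind _ _ rfl)))))).to ?_ ?_
  · exact h
  · exact hri.symm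
  · rfl
  · exact hcj.symm
  · rfl
  · rfl
  · rfl
  · have hb : (if (l.drop (env none)).head? = some true then (1 : ℤ) else 0) =
        if (I.entry (env (some i)) (env (some j))).testBit (env none) then 1 else 0 := by
      rw [List.head?_drop]
      exact if_congr (encodeNat_getElem? _ _) rfl rfl
    have happ : (l.take (env none)).map Symbol.bit ++
        ((l.drop (env none)).map Symbol.bit ++ .comma :: w) = l.map Symbol.bit ++ .comma :: w := by
      rw [← List.append_assoc, ← List.map_append, List.take_append_drop]
    simp only [canon, hb, Expr.eval, h, Mem.mk.injEq, and_self, and_true]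
    simp only [List.reverse_append, List.reverse_reverse, List.append_nil, List.append_assoc,
      happ]
  · simp only [List.length_append, List.length_reverse, List.length_map, List.length_take, canon,
      List.length_nil]
    omega

/-- The program that pushes the value of an expression. -/
noncomputable def Expr.compile : Expr → Cmd (Alphabet O)
  | bit i j => lookup i j
  | op f a b => .seq a.compile (.seq b.compile (applyOp f))
  | fold p z f b => .seq (.push .val (clip z)) (countdown p (.seq b.compile (applyOp f)))

/-- A polynomial bound for the running time of `Expr.compile`. -/
noncomputable def Expr.cost : Expr → Polynomial ℕ
  | bit _ _ => 33 * .X + 9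
  | op _ a b => a.cost + (b.cost + 5)
  | fold _ _ _ b => 1 + (.X * (b.cost + 5 + 6) + 2)

theorem bound_le_size (I : Instance) (p : Ptr) : I.bound p ≤ I.size := by
  cases p with
  | none => exact le_rfl
  | some _ => exact le_size I

/-- The compiled program pushes the value of the expression, leaves everything else as it was and
keeps the polynomial time bound. -/
theorem Expr.does_compile (I : Instance) (e : Expr) {s : Finset Ptr} {env : Ptr → ℕ}
    (he : e.Scoped s) (henv : InScope I s env) (vs : List Val) (out : List O) :
    Does e.compile (canon I env vs out) (canon I env (e.eval I env :: vs) out)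
      (e.cost.eval I.size) := by
  induction e generalizing s env vs with
  | bit i j =>
    refine (does_lookup (henv.1 _ he.1) (henv.1 _ he.2) (henv.le none) vs out).to rfl ?_
    simp [cost]
  | op f a b iha ihb =>
    refine ((iha he.1 henv vs).seq ((ihb he.2 henv _).seq (does_applyOp f rfl))).to rfl ?_
    simp [cost]
  | fold p z f b ih =>
    set g : ℕ → Val → Val := fun x v => clip (f v (b.eval I (Function.update env p x))) with hg
    -- the value after the iterations for the numbers from `x` up to the bound
    set F : ℕ → Val := fun x =>
      (List.range (I.bound p - x)).foldr (fun y => g (x + y)) (clip z) with hF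
    have hF' : ∀ x < I.bound p, F x = g x (F (x + 1)) := by
      intro x hx
      simp only [hF]
      rw [show I.bound p - x = I.bound p - (x + 1) + 1 by omega, List.range_succ_eq_map]
      simp only [List.foldr_cons, List.foldr_map, Nat.add_zero]
      congr 2
      funext y
      exact congrArg g (by omega : x + y.succ = x + 1 + y)
    have h := does_countdown (O := O) (I := I) (env := env) (p := p)
      (c := .seq b.compile (applyOp f)) (T := b.cost.eval I.size + 5)
      (F := fun x => (F x :: vs, out)) (henv.2 p he.1) (fun x hx => by
        refine ((ih he.2 (henv.insert hx) (F (x + 1) :: vs)).seq (does_applyOp f rfl)).to ?_ le_rfl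
        simp only [canon, hF' x hx, hg])
    have h0 : F (I.bound p) = clip z := by simp [hF]
    have h1 : F 0 = (fold p z f b).eval I env := by simp [hF, eval, hg]
    simp only [h0, h1] at h
    refine ((does_push_val _ (clip z)).seq h).to rfl ?_
    simp only [cost, Polynomial.eval_add, Polynomial.eval_mul, Polynomial.eval_X,
      Polynomial.eval_one, Polynomial.eval_ofNat]
    gcongr
    exact bound_le_size I p

end Loop

/-! ### A language of printing programs -/

/-- Programs that print a list of symbols depending on an instance. -/
inductive Printer (O : Type) : Type
  /-- print a symbol -/
  | emit (o : O)
  /-- print two lists, one after the other -/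
  | seq (a b : Printer O)
  /-- choose by whether the value of an expression is non-zero -/
  | cond (e : Expr) (a b : Printer O)
  /-- print a list for each value of the index `i`, in increasing order -/
  | each (i : Fin 4) (c : Printer O)
  /-- print as many copies of a symbol as the index `i` says -/
  | unary (i : Fin 4) (o : O)

section Printer

variable {O : Type}

/-- The list that a program prints. -/
noncomputable def Printer.print (I : Instance) : Printer O → (Ptr → ℕ) → List O
  | emit o, _ => [o]
  | seq a b, env => a.print I env ++ b.print I env
  | cond e a b, env => if (e.eval I env : ℤ) ≠ 0 then a.print I env else b.print I env
  | each i c, env => (List.range I.1).flatMap fun x => c.print I (Function.update env (some i) x)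
  | unary i o, env => List.replicate (env (some i)) o

/-- The expressions in the program are scoped, where the counters in `s` and those set by enclosing
loops are in use, and no loop sets an index that is in use. -/
def Printer.Scoped : Printer O → Finset Ptr → Prop
  | emit _, _ => True
  | seq a b, s => a.Scoped s ∧ b.Scoped s
  | cond e a b, s => e.Scoped s ∧ a.Scoped s ∧ b.Scoped s
  | each i c, s => some i ∉ s ∧ c.Scoped (insert (some i) s)
  | unary _ _, _ => True

/-- The stack program of a printing program. It works backwards, since the first symbol of the
output has to be pushed last. -/
noncomputable def Printer.compile : Printer O → Cmd (Alphabet O)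
  | emit o => .push .out o
  | seq a b => .seq b.compile a.compile
  | cond e a b => .seq e.compile (.choose .val fun v => .seq (.drop .val)
      (if ((v.getD (clip 0) : Val) : ℤ) ≠ 0 then a.compile else b.compile))
  | each i c => countdown (some i) c.compile
  | unary i o => .seq (untilEmpty (.ptr (some i)) (.seq (.drop (.ptr (some i)))
      (.seq (.push .cnt ()) (.push .out o)))) (restore (some i))

/-- A polynomial bound for the running time of `Printer.compile`. -/
noncomputable def Printer.cost : Printer O → Polynomial ℕ
  | emit _ => 1
  | seq a b => b.cost + a.cost
  | cond e a b => e.cost + (1 + (a.cost + b.cost) + 1)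
  | each _ c => .X * (c.cost + 6) + 2
  | unary _ _ => 7 * .X + 2

theorem does_unary (i : Fin 4) (o : O) (x : ℕ) (m : Mem O) (hm : m.ptr (some i) = x) :
    Does (untilEmpty (.ptr (some i)) (.seq (.drop (.ptr (some i)))
        (.seq (.push .cnt ()) (.push .out o)))) m
      { m with
        ptr := Function.update m.ptr (some i) 0, cnt := m.cnt + x,
        out := List.replicate x o ++ m.out } (4 * x + 1) := by
  induction x generalizing m with
  | zero =>
    refine does_untilEmpty_nil ?_ ?_
    · simp [Mem.stacks, hm]
    · cases m; simp_all
  | succ x ih =>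
    refine (((does_drop_ptr m (some i)).seq ((does_push_cnt _).seq
      (does_push_out _ o))).untilEmpty_cons (ih _ ?_) ?_).to ?_ ?_
    · simp [hm]
    · simp [Mem.stacks, hm, List.replicate_succ]
    · simp [add_assoc, add_comm 1, List.replicate_succ']
    · omega

/-- The compiled program puts the printed list in front of the output, leaves everything else as it
was and keeps the polynomial time bound. -/
theorem Printer.does_compile (I : Instance) (c : Printer O) {s : Finset Ptr} {env : Ptr → ℕ}
    (hc : c.Scoped s) (henv : InScope I s env) (vs : List Val) (out : List O) :
    Does c.compile (canon I env vs out) (canon I env vs (c.print I env ++ out))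
      (c.cost.eval I.size) := by
  induction c generalizing s env out with
  | emit o =>
    refine (does_push_out _ o).to rfl ?_
    simp [cost]
  | seq a b iha ihb =>
    refine ((ihb hc.2 henv out).seq (iha hc.1 henv _)).to ?_ ?_
    · simp [print]
    · simp [cost]
  | cond e a b iha ihb =>
    refine ((e.does_compile I hc.1 henv vs out).seq (T' := 1 + (a.cost.eval I.size +
      b.cost.eval I.size) + 1) (Does.choose ((does_drop_val _).seq ?_))).to rfl ?_
    · simp only [canon, Mem.stacks, List.head?_cons, Option.getD_some, List.tail_cons, print]
      by_cases hv : (e.eval I env : ℤ) = 0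
      · simp only [hv, ne_eq, not_true_eq_false, ↓reduceIte]
        exact (ihb hc.2.2 henv out).to rfl (Nat.le_add_left _ _)
      · simp only [hv, ne_eq, not_false_eq_true, ↓reduceIte]
        exact (iha hc.2.1 henv out).to rfl (Nat.le_add_right _ _)
    · simp [cost]
  | each i c ih =>
    -- the output for the numbers from `x` up to the bound
    set F : ℕ → List O := fun x => (List.range (I.1 - x)).flatMap
      (fun y => c.print I (Function.update env (some i) (x + y))) ++ out with hF
    have hF' : ∀ x < I.1, F x = c.print I (Function.update env (some i) x) ++ F (x + 1) := by
      intro x hx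
      simp only [hF]
      rw [show I.1 - x = I.1 - (x + 1) + 1 by omega, List.range_succ_eq_map]
      simp only [List.flatMap_cons, List.flatMap_map, Nat.add_zero, List.append_assoc]
      congr 3
      funext y
      exact congrArg (fun z => c.print I (Function.update env (some i) z))
        (by omega : x + y.succ = x + 1 + y)
    have h := does_countdown (O := O) (I := I) (env := env) (p := some i)
      (c := c.compile) (T := c.cost.eval I.size) (F := fun x => (vs, F x))
      (henv.2 _ hc.1) (fun x hx =>
        (ih hc.2 (henv.insert hx) (F (x + 1))).to (by simp only [hF' x hx]) le_rfl)
    have h0 : F (I.bound (some i)) = out := by simp [hF, Instance.bound]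
    have h1 : F 0 = (each i c).print I env ++ out := by simp [hF, print]
    simp only [h0, h1] at h
    refine h.to rfl ?_
    simp only [cost, Polynomial.eval_add, Polynomial.eval_mul, Polynomial.eval_X,
      Polynomial.eval_ofNat]
    gcongr
    exact bound_le_size I _
  | unary i o =>
    have hle : env (some i) ≤ I.size := (henv.le _).trans (bound_le_size I _)
    refine ((does_unary i o (env (some i)) _ rfl).seq (does_restore _ (env (some i)) _ ?_)).to ?_ ?_
    · simp [canon]
    · simp [canon, print]
    · simp only [cost, Polynomial.eval_add, Polynomial.eval_mul, Polynomial.eval_X,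
        Polynomial.eval_ofNat]
      omega

/-! ### Polynomial-time machines from printing programs -/

/-- Record that a symbol has been read: every symbol increases the counter of bit positions, and a
semicolon increases all index counters. -/
def countSymbol (s : Symbol) : Cmd (Alphabet O) :=
  if s = .semicolon then
    .seq (.push (.ptr none) ()) (.seq (.push (.ptr (some 0)) ()) (.seq (.push (.ptr (some 1)) ())
      (.seq (.push (.ptr (some 2)) ()) (.push (.ptr (some 3)) ()))))
  else .push (.ptr none) ()

/-- How much each counter increases when `l` is read. -/
def countIn (l : List Symbol) : Ptr → ℕ
  | none => l.length
  | some _ => l.count .semicolon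

theorem does_countSymbol (s : Symbol) (m : Mem O) :
    Does (countSymbol s) m { m with ptr := m.ptr + countIn [s] } 5 := by
  unfold countSymbol
  split_ifs with hs
  · refine ((does_push_ptr m none).seq ((does_push_ptr _ (some 0)).seq ((does_push_ptr _
      (some 1)).seq ((does_push_ptr _ (some 2)).seq (does_push_ptr _ (some 3)))))).to ?_ le_rfl
    simp only [Mem.mk.injEq, and_self, and_true, true_and]
    funext p
    rcases p with - | p
    · simp [countIn]
    · fin_cases p <;> simp [countIn, hs]
  · refine (does_push_ptr m none).to ?_ (by omega)
    simp only [Mem.mk.injEq, and_self, and_true, true_and]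
    funext p
    rcases p with - | p <;> simp [countIn, hs]

/-- Set all counters to their bounds, by reading the input once. -/
def setup : Cmd (Alphabet O) :=
  .seq (untilEmpty .inp (.choose .inp fun o => o.elim (.drop .inp) fun s =>
    .seq (.drop .inp) (.seq (.push .aux s) (countSymbol s)))) rewind

theorem does_count (l : List Symbol) (m : Mem O) (hm : m.inp = l) :
    Does (untilEmpty .inp (.choose .inp fun o => o.elim (.drop .inp) fun s =>
        .seq (.drop .inp) (.seq (.push .aux s) (countSymbol s)))) m
      { m with inp := [], aux := l.reverse ++ m.aux, ptr := m.ptr + countIn l }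
      (9 * l.length + 1) := by
  induction l generalizing m with
  | nil =>
    refine does_untilEmpty_nil ?_ ?_
    · simp [Mem.stacks, hm]
    · have : countIn [] = 0 := by funext p; cases p <;> rfl
      cases m
      simp_all
  | cons s l ih =>
    have h1 : Does (.choose .inp fun o => o.elim (.drop .inp) fun s =>
        .seq (.drop .inp) (.seq (.push .aux s) (countSymbol s))) m
        { m with inp := l, aux := s :: m.aux, ptr := m.ptr + countIn [s] } 8 := by
      refine Does.choose (T := 7) ?_
      have := (does_drop_inp m).seq ((does_push_aux _ s).seq (does_countSymbol s _))
      simpa [Mem.stacks, hm] using this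
    refine (h1.untilEmpty_cons (ih _ rfl) ?_).to ?_ ?_
    · simp [Mem.stacks, hm]
    · simp only [Mem.mk.injEq, List.reverse_cons, List.append_assoc, List.cons_append,
        List.nil_append, and_self, and_true, true_and]
      funext p
      rcases p with - | p <;> simp [countIn, List.count_cons] <;> omega
    · simp only [List.length_cons]
      omega

/-- The stacks at the start of a computation. -/
def initialMem (I : Instance) : Mem O where
  inp := encodeInstance I
  aux := []
  ptr := 0
  rem := 0
  cnt := 0
  val := []
  out := []

theorem does_setup (I : Instance) :
    Does setup (initialMem I : Mem O) (canon I I.bound [] []) (13 * I.size + 2) := by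
  refine ((does_count _ _ rfl).seq (does_rewind _ _ rfl)).to ?_ ?_
  · simp only [initialMem, canon, List.append_nil, List.reverse_reverse, Mem.mk.injEq, and_self,
      and_true, true_and, zero_add]
    constructor
    · funext p
      rcases p with - | p
      · rfl
      · exact count_semicolon_encodeInstance I
    · funext p
      simp
  · simp only [initialMem, List.append_nil, List.length_reverse, Instance.size]
    omega

/-- Empty all stacks that are not empty after the output has been printed, except the output. -/
def cleanup : Cmd (Alphabet O) :=
  .seq (clear .inp) (.seq (clear (.ptr none)) (.seq (clear (.ptr (some 0)))
    (.seq (clear (.ptr (some 1))) (.seq (clear (.ptr (some 2))) (clear (.ptr (some 3)))))))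

/-- The stacks at the end of a computation. -/
def finalMem (out : List O) : Mem O where
  inp := []
  aux := []
  ptr := 0
  rem := 0
  cnt := 0
  val := []
  out := out

theorem does_cleanup (I : Instance) (out : List O) :
    Does cleanup (canon I I.bound [] out) (finalMem out) (12 * I.size + 6) := by
  have h := le_size I
  refine ((does_clear_inp _ _ rfl).seq ((does_clear_ptr none I.size _ rfl).seq
    ((does_clear_ptr (some 0) I.1 _ ?_).seq ((does_clear_ptr (some 1) I.1 _ ?_).seq
    ((does_clear_ptr (some 2) I.1 _ ?_).seq (does_clear_ptr (some 3) I.1 _ ?_)))))).to ?_ ?_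
  · simp [canon, Instance.bound]
  · simp [canon, Instance.bound]
  · simp [canon, Instance.bound]
  · simp [canon, Instance.bound]
  · simp only [canon, finalMem, Mem.mk.injEq, and_self, and_true, true_and]
    constructor
    · funext p
      rcases p with - | p
      · simp
      · fin_cases p <;> simp
    · funext p
      simp
  · simp only [canon]
    rw [← Instance.size]
    omega

/-- A function whose encoded values are printed by a program is computable in polynomial time; its
time bound may be increased by any polynomial. -/
theorem Printer.exists_polyTime [Fintype O] (c : Printer O) (hc : c.Scoped ∅) {β : Type}
    {eb : β → List O} {f : Instance → β} (h : ∀ I, eb (f I) = c.print I I.bound) :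
    ∃ p : Polynomial ℕ, ∀ q : Polynomial ℕ,
      ∃ A : Turing.TM2ComputableInPolyTime encodeInstance eb f, A.time = p + q := by
  refine ⟨(13 * .X + 2) + (c.cost + (12 * .X + 6)) + 1, fun q => ?_⟩
  have key : ∀ I : Instance, Does (.seq setup (.seq c.compile cleanup)) (initialMem I)
      (finalMem (eb (f I))) ((13 * I.size + 2) + (c.cost.eval I.size + (12 * I.size + 6))) := by
    intro I
    have hI : InScope I ∅ I.bound := ⟨by simp, fun _ _ => rfl⟩
    have := c.does_compile I hc hI [] []
    rw [List.append_nil, ← h] at this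
    exact (does_setup I).seq (this.seq (does_cleanup I _))
  choose t ht hexec using key
  refine ⟨{
    tm := Cmd.toMachine (Γ := Alphabet O) StackName.inp StackName.out
      (.seq setup (.seq c.compile cleanup))
    inputAlphabet := Equiv.refl Symbol
    outputAlphabet := Equiv.refl O
    time := _
    outputsFun := fun I =>
      { steps := t I + 1
        evals_in_steps := ?_
        steps_le_m := ?_ } }, rfl⟩
  · have hs : (initialMem I : Mem O).stacks = (Turing.initList
        (Cmd.toMachine .inp .out (.seq setup (.seq (c.compile) cleanup)))
        ((encodeInstance I).map (Equiv.refl Symbol).invFun)).stk := by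
      funext k
      rcases k with - | - | _ | _ | - | - | - <;> first | rfl | exact (List.map_id _).symm
    have hf : (finalMem (eb (f I)) : Mem O).stacks = (Turing.haltList
        (Cmd.toMachine .inp .out (.seq setup (.seq (c.compile) cleanup)))
        ((eb (f I)).map (Equiv.refl O).invFun)).stk := by
      funext k
      rcases k with - | - | _ | _ | - | - | - <;> first | rfl | exact (List.map_id _).symm
    have := (hexec I).evalsTo (k₀ := .inp) (k₁ := .out)
    rw [hs, hf] at this
    exact this
  · have := ht I
    simp only [Polynomial.eval_add, Polynomial.eval_mul, Polynomial.eval_X,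
      Polynomial.eval_ofNat, Polynomial.eval_one]
    rw [← Instance.size]
    omega

end Printer

/-! ### Arithmetic and logic in the language of expressions -/

/-- An invariant for loops that count downwards. -/
theorem foldr_range_induction {α : Type} (P : ℕ → α → Prop) {g : ℕ → α → α} {n : ℕ} {z : α}
    (hz : P n z) (hg : ∀ x < n, ∀ v, P (x + 1) v → P x (g x v)) :
    P 0 ((List.range n).foldr g z) := by
  induction n generalizing z with
  | zero => exact hz
  | succ n ih =>
    rw [List.range_succ, List.foldr_append]
    exact ih (hg n (by omega) z hz) fun x hx => hg x (by omega)

theorem div_two_pow (a x : ℕ) :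
    a / 2 ^ x = 2 * (a / 2 ^ (x + 1)) + if a.testBit x then 1 else 0 := by
  rw [Nat.pow_succ, ← Nat.div_div_eq_div_mul, Nat.testBit_eq_decide_div_mod_eq]
  simp only [decide_eq_true_eq]
  split_ifs <;> omega

namespace Expr

/-- The expression, read as a formula, holds: its value is not zero. -/
def Holds (I : Instance) (e : Expr) (env : Ptr → ℕ) : Prop := (e.eval I env : ℤ) ≠ 0

/-- The entry `(i, j)`, clipped; computed by Horner's rule from the leading bit downwards. -/
def small (i j : Fin 4) : Expr := fold none 0 (fun v b => 2 * v + b) (bit i j)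

/-- The difference of the sum of the entries `(k, l)` and `(p, q)` and the entry `(i, j)`, clipped.
Horner's rule works here, since the clipped value of `2 * v + d` for `-1 ≤ d ≤ 2` depends only on
the clipped value of `v`. -/
def diff (i j k l p q : Fin 4) : Expr :=
  fold none 0 (fun v d => 2 * v + d) (op (· - ·) (op (· + ·) (bit k l) (bit p q)) (bit i j))

/-- The value of `e` is `z`. -/
def is (e : Expr) (z : ℤ) : Expr := op (fun v _ => if v = z then 1 else 0) e e

/-- The value of `e` is not negative. -/
def nonneg (e : Expr) : Expr := op (fun v _ => if 0 ≤ v then 1 else 0) e e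

/-- Conjunction. -/
def and (a b : Expr) : Expr := op (fun v w => if v ≠ 0 ∧ w ≠ 0 then 1 else 0) a b

/-- Disjunction. -/
def or (a b : Expr) : Expr := op (fun v w => if v ≠ 0 ∨ w ≠ 0 then 1 else 0) a b

/-- Negation. -/
def not (a : Expr) : Expr := a.is 0

/-- Universal quantification over an index. -/
def all (i : Fin 4) (a : Expr) : Expr :=
  fold (some i) 1 (fun v w => if v ≠ 0 ∧ w ≠ 0 then 1 else 0) a

/-- Existential quantification over an index. -/
def ex (i : Fin 4) (a : Expr) : Expr :=
  fold (some i) 0 (fun v w => if v ≠ 0 ∨ w ≠ 0 then 1 else 0) a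

/-- The number of values of an index for which `a` holds, clipped. -/
def count (i : Fin 4) (a : Expr) : Expr :=
  fold (some i) 0 (fun v w => v + if w ≠ 0 then 1 else 0) a

variable {I : Instance} {env : Ptr → ℕ}

theorem coe_eval_small (i j : Fin 4) :
    ((small i j).eval I env : ℤ) = min 3 (I.entry (env (some i)) (env (some j)) : ℤ) := by
  refine (foldr_range_induction (fun x (v : Val) =>
    (v : ℤ) = min 3 ((I.entry (env (some i)) (env (some j)) / 2 ^ x : ℕ) : ℤ)) ?_ ?_).trans ?_
  · rw [Instance.bound, Nat.div_eq_of_lt (entry_lt_two_pow I _ _), coe_clip]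
    rfl
  · intro x _ v hv
    simp only [eval, coe_clip, hv, ne_eq, reduceCtorEq, not_false_eq_true, Function.update_of_ne,
      Function.update_self, div_two_pow _ x]
    generalize I.entry (env (some i)) (env (some j)) / 2 ^ (x + 1) = d
    split_ifs <;> push_cast <;> omega
  · simp

theorem coe_eval_diff (i j k l p q : Fin 4) :
    ((diff i j k l p q).eval I env : ℤ) =
      clip (I.entry (env (some k)) (env (some l)) + I.entry (env (some p)) (env (some q)) -
        I.entry (env (some i)) (env (some j))) := by
  set a := I.entry (env (some i)) (env (some j)) with ha
  set b := I.entry (env (some k)) (env (some l)) with hb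
  set c := I.entry (env (some p)) (env (some q)) with hc
  refine (foldr_range_induction (fun x (v : Val) =>
    (v : ℤ) = clip ((b / 2 ^ x : ℕ) + (c / 2 ^ x : ℕ) - (a / 2 ^ x : ℕ))) ?_ ?_).trans ?_
  · rw [Instance.bound, Nat.div_eq_of_lt (entry_lt_two_pow I _ _),
      Nat.div_eq_of_lt (entry_lt_two_pow I _ _), Nat.div_eq_of_lt (entry_lt_two_pow I _ _)]
    rfl
  · intro x _ v hv
    simp only [eval, coe_clip, ne_eq, reduceCtorEq, not_false_eq_true, Function.update_of_ne,
      Function.update_self, div_two_pow _ x, ← ha, ← hb, ← hc] at hv ⊢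
    rw [hv]
    split_ifs <;> push_cast <;> omega
  · simp

theorem holds_is {e : Expr} {z : ℤ} : (e.is z).Holds I env ↔ (e.eval I env : ℤ) = z := by
  simp only [Holds, is, eval, coe_clip]
  split_ifs <;> simp_all

theorem holds_nonneg {e : Expr} : e.nonneg.Holds I env ↔ 0 ≤ (e.eval I env : ℤ) := by
  simp only [Holds, nonneg, eval, coe_clip]
  split_ifs with h <;> simp [h]

theorem holds_and {a b : Expr} : (a.and b).Holds I env ↔ a.Holds I env ∧ b.Holds I env := by
  simp only [Holds, and, eval, coe_clip]
  split_ifs with h <;> simp_all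

theorem holds_or {a b : Expr} : (a.or b).Holds I env ↔ a.Holds I env ∨ b.Holds I env := by
  simp only [Holds, or, eval, coe_clip]
  split_ifs with h <;> simp_all

theorem holds_not {a : Expr} : a.not.Holds I env ↔ ¬ a.Holds I env := by
  rw [not, holds_is, Holds, not_not]

theorem holds_all {i : Fin 4} {a : Expr} : (a.all i).Holds I env ↔
    ∀ x : Fin I.1, a.Holds I (Function.update env (some i) x) := by
  rw [Fin.forall_iff]
  have H : ∀ l : List ℕ, ((l.foldr (fun x v => clip (if (v : ℤ) ≠ 0 ∧
      (a.eval I (Function.update env (some i) x) : ℤ) ≠ 0 then 1 else 0)) (clip 1) : Val) : ℤ) ≠ 0 ↔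
      ∀ x ∈ l, a.Holds I (Function.update env (some i) x) := by
    intro l
    induction l with
    | nil => simp [coe_clip]
    | cons x l ih =>
      rw [List.foldr_cons, List.forall_mem_cons, ← ih, coe_clip, Holds]
      split_ifs with h
      · simp [h]
      · simpa using fun h1 h2 => h ⟨h2, h1⟩
  exact (H (List.range I.1)).trans (by simp)

theorem holds_ex {i : Fin 4} {a : Expr} : (a.ex i).Holds I env ↔
    ∃ x : Fin I.1, a.Holds I (Function.update env (some i) x) := by
  rw [Fin.exists_iff]
  have H : ∀ l : List ℕ, ((l.foldr (fun x v => clip (if (v : ℤ) ≠ 0 ∨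
      (a.eval I (Function.update env (some i) x) : ℤ) ≠ 0 then 1 else 0)) (clip 0) : Val) : ℤ) ≠ 0 ↔
      ∃ x ∈ l, a.Holds I (Function.update env (some i) x) := by
    intro l
    induction l with
    | nil => simp [coe_clip]
    | cons x l ih =>
      rw [List.foldr_cons, List.exists_mem_cons_iff, ← ih, coe_clip, Holds]
      split_ifs with h
      · simpa using h.symm
      · rw [not_or] at h
        simpa using ⟨not_not.1 h.2, not_not.1 h.1⟩
  exact (H (List.range I.1)).trans (by simp)

open Classical in
theorem eval_count {i : Fin 4} {a : Expr} : (a.count i).eval I env =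
    clip ((List.range I.1).countP fun x => decide (a.Holds I (Function.update env (some i) x))) := by
  have H : ∀ l : List ℕ, l.foldr (fun x v => clip ((v : ℤ) + if
      (a.eval I (Function.update env (some i) x) : ℤ) ≠ 0 then 1 else 0)) (clip 0) =
      clip (l.countP fun x => decide (a.Holds I (Function.update env (some i) x))) := by
    intro l
    induction l with
    | nil => rfl
    | cons x l ih =>
      apply Subtype.ext
      rw [List.foldr_cons, List.countP_cons, ih, coe_clip, coe_clip, coe_clip]
      by_cases h : (a.eval I (Function.update env (some i) x) : ℤ) = 0
      · simp only [Holds, h, ne_eq, not_true_eq_false, decide_false, Bool.false_eq_true, ↓reduceIte]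
        omega
      · simp only [Holds, h, ne_eq, not_false_eq_true, decide_true, ↓reduceIte]
        push_cast
        omega
  exact H (List.range I.1)

/-- A formula is satisfied by exactly one index iff the clipped number of solutions is `1`. -/
theorem holds_count_is_one {i : Fin 4} {a : Expr} : ((a.count i).is 1).Holds I env ↔
    ∃! x : Fin I.1, a.Holds I (Function.update env (some i) x) := by
  classical
  rw [holds_is, eval_count, coe_clip, List.countP_eq_length_filter]
  set l := (List.range I.1).filter fun x => decide (a.Holds I (Function.update env (some i) x))
    with hl
  have hmem : ∀ x, x ∈ l ↔ x < I.1 ∧ a.Holds I (Function.update env (some i) x) := by simp [hl]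
  have hnodup : l.Nodup := List.nodup_range.filter _
  constructor
  · intro h
    obtain ⟨x, hx⟩ := List.length_eq_one_iff.1 (by omega : l.length = 1)
    have h1 := (hmem x).1 (by simp [hx])
    refine ⟨⟨x, h1.1⟩, h1.2, fun y hy => ?_⟩
    have := (hmem y).2 ⟨y.2, hy⟩
    rw [hx, List.mem_singleton] at this
    exact Fin.ext this
  · rintro ⟨x, hx, huniq⟩
    have : l = [(x : ℕ)] := by
      rw [← List.perm_singleton, List.perm_ext_iff_of_nodup hnodup (List.nodup_singleton _)]
      intro y
      rw [hmem, List.mem_singleton]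
      constructor
      · rintro ⟨hy, h⟩
        exact congrArg Fin.val (huniq ⟨y, hy⟩ h)
      · rintro rfl
        exact ⟨x.2, hx⟩
    rw [this]
    rfl

/-- The entry `(i, j)` is `z`, for `z = 0, 1, 2`; for `z = 3`, it is at least `3`. -/
def entryIs (i j : Fin 4) (z : ℤ) : Expr := (small i j).is z

theorem holds_entryIs {i j : Fin 4} {z : ℤ} : (entryIs i j z).Holds I env ↔
    min 3 (I.entry (env (some i)) (env (some j)) : ℤ) = z := by
  rw [entryIs, holds_is, coe_eval_small]

/-- The entry `(i, j)` is at most the sum of the entries `(k, l)` and `(p, q)`. -/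
def leSum (i j k l p q : Fin 4) : Expr := (diff i j k l p q).nonneg

theorem holds_leSum {i j k l p q : Fin 4} : (leSum i j k l p q).Holds I env ↔
    I.entry (env (some i)) (env (some j)) ≤
      I.entry (env (some k)) (env (some l)) + I.entry (env (some p)) (env (some q)) := by
  rw [leSum, holds_nonneg, coe_eval_diff, coe_clip]
  omega

/-- The entry `(i, j)` is the sum of the entries `(k, l)` and `(p, q)`. -/
def eqSum (i j k l p q : Fin 4) : Expr := (diff i j k l p q).is 0

theorem holds_eqSum {i j k l p q : Fin 4} : (eqSum i j k l p q).Holds I env ↔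
    I.entry (env (some i)) (env (some j)) =
      I.entry (env (some k)) (env (some l)) + I.entry (env (some p)) (env (some q)) := by
  rw [eqSum, holds_is, coe_eval_diff, coe_clip]
  omega

/-! ### The formulas and programs for the problem -/

/-- The index `i` is forced, see `IsForced`; `j` and `k` serve as bound variables. -/
def forced (i j k : Fin 4) : Expr :=
  ((entryIs i j 2).and (((entryIs i k 1).and (entryIs k j 1)).ex k).not).ex j

/-- The formula that describes the YES-instances. Strict positivity outside the diagonal is
expressed by counting the zeros in a row, as there is no atomic formula for the equality of
indices; and symmetry, given that the diagonal is zero, by an inequality between sums. -/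
def good : Expr :=
  (((entryIs 0 0 0).all 0).and
    ((((entryIs 0 1 0).count 1).is 1).all 0)).and
  ((((leSum 0 1 1 0 0 0).all 1).all 0).and
    ((((leSum 0 1 0 2 2 1).all 2).all 1).all 0)) |>.and
  (((((entryIs 0 1 3).not.or ((forced 0 2 3).and (forced 1 2 3)).not).all 1).all 0).and
    ((((entryIs 0 1 3).not.or
      (((((entryIs 0 2 1).or (entryIs 0 2 2))).and (eqSum 0 1 0 2 2 1)).ex 2)).all 1).all 0))

@[simp]
theorem entry_coe (i j : Fin I.1) : I.entry i j = I.2 i j := by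
  simp [Instance.entry]

theorem holds_forced {i j k : Fin 4} (hij : i ≠ j) (hik : i ≠ k) (hjk : j ≠ k) (x : Fin I.1)
    (hx : env (some i) = x) : (forced i j k).Holds I env ↔ IsForced I.2 x := by
  simp only [forced, holds_ex, holds_and, holds_not, holds_entryIs, IsForced, Function.update_self,
    Function.update_of_ne, ne_eq, Option.some.injEq, hij, hik, hjk, not_false_eq_true, hx,
    entry_coe]
  refine exists_congr fun y => and_congr (by omega) (not_congr (exists_congr fun z => ?_))
  exact and_congr (by omega) (by omega)

theorem holds_good : good.Holds I env ↔ IsGood I.2 := by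
  have hf : ∀ x y : Fin I.1, (forced 0 2 3).Holds I
      (Function.update (Function.update env (some 0) x) (some 1) y) ↔ IsForced I.2 x := fun x y =>
    holds_forced (by decide) (by decide) (by decide) x (by simp)
  have hf' : ∀ x y : Fin I.1, (forced 1 2 3).Holds I
      (Function.update (Function.update env (some 0) x) (some 1) y) ↔ IsForced I.2 y := fun x y =>
    holds_forced (by decide) (by decide) (by decide) y (by simp)
  simp only [good, holds_and, holds_all, holds_ex, holds_or, holds_not, holds_count_is_one,
    holds_entryIs, holds_leSum, holds_eqSum, hf, hf']
  simp only [Function.update_self, Function.update_of_ne, ne_eq, Option.some.injEq, Fin.reduceEq,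
    not_false_eq_true, entry_coe]
  constructor
  · rintro ⟨⟨⟨h1, h2⟩, h3, h4⟩, h5, h6⟩
    have hd : ∀ x, I.2 x x = 0 := fun x => by have := h1 x; omega
    refine ⟨⟨hd, fun x y hxy => ?_, fun x y => ?_, fun x y z => h4 x y z⟩, fun x y hxy => ?_,
      fun x y hxy => ?_⟩
    · rw [Nat.pos_iff_ne_zero]
      intro h0
      exact hxy ((h2 x).unique (h1 x) (by omega))
    · have := h3 x y
      have := h3 y x
      have := hd x
      have := hd y
      omega
    · exact (h5 x y).resolve_left (by omega)
    · obtain ⟨z, hz, hs⟩ := (h6 x y).resolve_left (by omega)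
      exact ⟨z, by omega, hs⟩
  · intro h
    have hD := h.isDistanceMatrix
    refine ⟨⟨⟨fun x => ?_, fun x => ⟨x, ?_, fun y hy => ?_⟩⟩, fun x y => ?_, hD.triangle⟩,
      fun x y => ?_, fun x y => ?_⟩
    · simp [hD.diag]
    · simp [hD.diag]
    · by_contra hne
      have := hD.pos x y (Ne.symm hne)
      omega
    · rw [hD.symm x y]
      omega
    · by_cases hxy : 2 < I.2 x y
      · exact Or.inr (h.not_forced x y hxy)
      · exact Or.inl (by omega)
    · by_cases hxy : 2 < I.2 x y
      · obtain ⟨z, hz, hs⟩ := h.split x y hxy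
        exact Or.inr ⟨z, by omega, hs⟩
      · exact Or.inl (by omega)

theorem scoped_good : good.Scoped ∅ := by
  simp [good, Scoped, ex, all, count, and, or, not, is, nonneg, entryIs, leSum, eqSum, diff, small,
    forced]

end Expr

namespace Printer

/-- Print the truth value of a formula. -/
def bit (e : Expr) : Printer Symbol := .cond e (.emit (.bit true)) (.emit (.bit false))

/-- Print the encoding of the graph of the least assignment. -/
def candidate : Printer Symbol :=
  .seq (.seq
    (.each 0 (.seq (.seq (.each 1 (bit (.entryIs 0 1 1))) (bit (.forced 0 1 2)))
      (.emit .semicolon)))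
    (.seq (.seq (.each 1 (bit (.forced 1 2 3))) (.emit (.bit false))) (.emit .semicolon)))
    (.each 0 (.seq (.unary 0 (.bit true)) (.emit .comma)))

/-- Print the answer of the algorithm. -/
def answer : Printer Symbol :=
  .cond .good (.seq (.emit (.bit true)) candidate) (.emit (.bit false))

theorem scoped_answer : answer.Scoped ∅ := by
  refine ⟨Expr.scoped_good, ?_, trivial⟩
  simp [candidate, bit, Scoped, Expr.Scoped, Expr.entryIs, Expr.is, Expr.small, Expr.forced,
    Expr.ex, Expr.and, Expr.not]

/-- Print the decision of the problem. -/
def verdict : Printer Bool := .cond .good (.emit true) (.emit false)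

theorem scoped_verdict : verdict.Scoped ∅ := ⟨Expr.scoped_good, trivial, trivial⟩

variable {I : Instance} {env : Ptr → ℕ}

theorem print_cond_pos {O : Type} {e : Expr} (a b : Printer O) (h : e.Holds I env) :
    (cond e a b).print I env = a.print I env := if_pos h

theorem print_cond_neg {O : Type} {e : Expr} (a b : Printer O) (h : ¬ e.Holds I env) :
    (cond e a b).print I env = b.print I env := if_neg h

theorem print_bit {e : Expr} {p : Prop} [Decidable p] (h : e.Holds I env ↔ p) :
    (bit e).print I env = [.bit (decide p)] := by
  by_cases hp : p
  · rw [bit, print_cond_pos _ _ (h.2 hp), decide_eq_true hp]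
    rfl
  · rw [bit, print_cond_neg _ _ (fun h' => hp (h.1 h')), decide_eq_false hp]
    rfl

theorem print_emit {O : Type} (o : O) : (emit o).print I env = [o] := rfl

theorem print_seq {O : Type} (a b : Printer O) :
    (seq a b).print I env = a.print I env ++ b.print I env := rfl

theorem print_unary {O : Type} (i : Fin 4) (o : O) :
    (unary i o).print I env = List.replicate (env (some i)) o := rfl

theorem print_each {O : Type} (i : Fin 4) (c : Printer O) : (each i c).print I env =
    (List.finRange I.1).flatMap fun x : Fin I.1 =>
      c.print I (Function.update env (some i) (x : ℕ)) := by
  have h : List.range I.1 = (List.finRange I.1).map Fin.val :=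
    List.ext_getElem (by simp) (by simp)
  rw [print, h, List.flatMap_map]

open Classical in
theorem print_candidate (hD : IsDistanceMatrix I.2) : candidate.print I env =
    encodeCandidate ⟨I.1, extGraph I.2 (leastAssignment I.2), Fin.castSucc⟩ := by
  have hadj : ∀ x y : Fin I.1, (bit (.entryIs 0 1 1)).print I
      (Function.update (Function.update env (some 0) x) (some 1) y) =
      [.bit (decide ((extGraph I.2 (leastAssignment I.2)).Adj x.castSucc y.castSucc))] := by
    intro x y
    apply print_bit
    rw [Expr.holds_entryIs, extGraph_adj_castSucc, graphOf_adj hD]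
    simp only [Function.update_self, Function.update_of_ne, ne_eq, Option.some.injEq,
      Fin.reduceEq, not_false_eq_true, Expr.entry_coe]
    omega
  have hlast : ∀ x : Fin I.1, (bit (.forced 0 1 2)).print I (Function.update env (some 0) x) =
      [.bit (decide ((extGraph I.2 (leastAssignment I.2)).Adj x.castSucc (Fin.last I.1)))] := by
    intro x
    apply print_bit
    rw [extGraph_adj_last, leastAssignment_eq_true hD]
    exact Expr.holds_forced (by decide) (by decide) (by decide) x (by simp)
  have hlast' : ∀ x : Fin I.1, (bit (.forced 1 2 3)).print I (Function.update env (some 1) x) =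
      [.bit (decide ((extGraph I.2 (leastAssignment I.2)).Adj (Fin.last I.1) x.castSucc))] := by
    intro x
    apply print_bit
    rw [SimpleGraph.adj_comm, extGraph_adj_last, leastAssignment_eq_true hD]
    exact Expr.holds_forced (by decide) (by decide) (by decide) x (by simp)
  simp only [candidate, encodeCandidate, print_emit, print_seq, print_unary, print_each, hadj,
    hlast, hlast', List.finRange_succ_last, List.flatMap_append, List.map_append, List.flatMap_map, List.map_map]
  simp [Function.comp_def, List.map_eq_flatMap]

/-- For a matrix that is not a YES-instance, the algorithm answers `none` whatever the assignment, so
the program has to print the right graph for YES-instances only. There `D` is a distance matrix,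
and the least assignment consists of the forced indices. -/
theorem print_answer (I : Instance) :
    answer.print I env = encodeAnswer (algorithm leastSolve I) := by
  by_cases h : YesInstance 1 I.2
  · obtain ⟨X, hX, -, halg⟩ := algorithm_eq_some isTwoSatAnswer_leastSolve h
    have hX' : X = leastAssignment I.2 := by
      unfold leastSolve at hX
      split_ifs at hX
      exact (Option.some_injective _ hX).symm
    subst hX'
    rw [answer, print_cond_pos _ _ (Expr.holds_good.2 (yesInstance_iff_isGood.1 h)),
      show I = ⟨I.1, I.2⟩ from rfl, halg, encodeAnswer, print, print_candidate h.isDistanceMatrix]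
    rfl
  · rw [answer, print_cond_neg _ _ (fun hg => h (yesInstance_iff_isGood.2 (Expr.holds_good.1 hg))),
      show I = ⟨I.1, I.2⟩ from rfl, algorithm_eq_none h]
    rfl

theorem print_verdict (I : Instance) :
    verdict.print I env = encodeBool (decision 1 I) := by
  by_cases h : YesInstance 1 I.2
  · have hd : decision 1 I = true := by simp [decision, h]
    rw [verdict, print_cond_pos _ _ (Expr.holds_good.2 (yesInstance_iff_isGood.1 h)), hd]
    rfl
  · have hd : decision 1 I = false := by simp [decision, h]
    rw [verdict, print_cond_neg _ _ (fun hg => h (yesInstance_iff_isGood.2 (Expr.holds_good.1 hg))),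
      hd]
    rfl

end Printer

end CombDMR

theorem theorem2 :
    -- with any answers to the 2-SAT instances `φ₁`, the algorithm is correct
    (∀ solve : (n : ℕ) → Matrix (Fin n) (Fin n) ℕ → Option (Fin n → Bool),
      (∀ (n : ℕ) (D : Matrix (Fin n) (Fin n) ℕ),
        CombDMR.IsTwoSatAnswer (CombDMR.phi₁ D) (solve n D)) →
      ∀ (n : ℕ) (D : Matrix (Fin n) (Fin n) ℕ),
        (¬ CombDMR.YesInstance 1 D → CombDMR.algorithm solve ⟨n, D⟩ = none) ∧
        (CombDMR.YesInstance 1 D →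
          ∃ (G : SimpleGraph (Fin (n + 1))) (Φ : Fin n → Fin (n + 1)),
            CombDMR.algorithm solve ⟨n, D⟩ = some ⟨n, (G, Φ)⟩ ∧ CombDMR.IsRealisation G Φ D)) ∧
    -- for some such answers, it runs in polynomial time, and 1-CombDMR is decided in the same time
    (∃ solve : (n : ℕ) → Matrix (Fin n) (Fin n) ℕ → Option (Fin n → Bool),
      (∀ (n : ℕ) (D : Matrix (Fin n) (Fin n) ℕ),
        CombDMR.IsTwoSatAnswer (CombDMR.phi₁ D) (solve n D)) ∧
      ∃ (A : Turing.TM2ComputableInPolyTime CombDMR.encodeInstance Computability.encodeBool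
            (CombDMR.decision 1))
        (B : Turing.TM2ComputableInPolyTime CombDMR.encodeInstance CombDMR.encodeAnswer
            (CombDMR.algorithm solve)),
        A.time = B.time) ∧
    -- the graph of any satisfying assignment has the distance matrix of the 2-skeleton
    (∀ (n : ℕ) (D : Matrix (Fin n) (Fin n) ℕ), CombDMR.IsDistanceMatrix D →
      ∀ X : Fin n → Bool, CombDMR.Satisfies X (CombDMR.phi₁ D) →
        ∀ i j : Fin n, CombDMR.extDist D X i j = CombDMR.skeletonDist D 2 i j) := by
  refine ⟨fun solve hsolve n D => ⟨CombDMR.algorithm_eq_none, fun h => ?_⟩, ?_,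
    fun n D hD X hX i j => CombDMR.extDist_eq_skeletonDist hD hX i j⟩
  · obtain ⟨X, -, hX, halg⟩ := CombDMR.algorithm_eq_some hsolve h
    exact ⟨_, _, halg, CombDMR.isRealisation_extGraph (h.extDist_eq hX)⟩
  · refine ⟨CombDMR.leastSolve, CombDMR.isTwoSatAnswer_leastSolve, ?_⟩
    obtain ⟨p, hp⟩ := CombDMR.Printer.verdict.exists_polyTime CombDMR.Printer.scoped_verdict
      (fun I => (CombDMR.Printer.print_verdict I).symm)
    obtain ⟨q, hq⟩ := CombDMR.Printer.answer.exists_polyTime CombDMR.Printer.scoped_answer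
      (fun I => (CombDMR.Printer.print_answer I).symm)
    -- both machines get the sum of their time bounds as the common bound
    obtain ⟨A, hA⟩ := hp q
    obtain ⟨B, hB⟩ := hq p
    exact ⟨A, B, by rw [hA, hB, add_comm]⟩
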